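/- Let $N\ge 1$ and let $H_1,\dots,H_N$ be complex Hilbert spaces, all but at most one of which are finite-dimensional. Let $H=H_1\otimes\cdots\otimes H_N$ be their Hilbert space tensor product and let $$V=\{\xi_1\otimes\cdots\otimes\xi_N:\ \xi_k\in H_k,\ \|\xi_k\|=1\}$$ be the set of decomposable unit vectors. For $X\in\mathcal B(H)$ put $\|X\|_V=\sup_{\xi,\eta\in V}|\langle X\xi,\eta\rangle|$, let $\mathcal A=\{K+\lambda\mathbf 1: K\in\mathcal B(H)\text{ compact},\ \lambda\in\mathbb C\}$, and for a normal linear functional $\rho$ on $\mathcal B(H)$ define its entanglement by $$E(\rho)=\sup\{|\rho(X)|:\ X\in\mathcal A,\ \|X\|_V\le 1\}\in[0,+\infty].$$ For a Hilbert space $K$ let $\mathcal L^1(K)$ be the Banach space of trace class operators on $K$ with the norm $\|T\|=\operatorname{trace}|T|$, and let $\|\cdot\|_\gamma$ be the projective norm (greatest cross norm) on $\mathcal L^1(H_1)\otimes\cdots\otimes\mathcal L^1(H_N)$, $$\|z\|_\gamma=\inf\Big\{\sum_{j=1}^n\|T^j_1\|\cdots\|T^j_N\|:\ n\ge 0,\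 z=\sum_{j=1}^n T^j_1\otimes\cdots\otimes T^j_N,\ T^j_k\in\mathcal L^1(H_k)\Big\}.$$ Let $\rho$ be a normal state of $\mathcal B(H)$ with density operator $A\in\mathcal L^1(H)$, i.e. $\rho(X)=\operatorname{trace}(AX)$ for all $X\in\mathcal B(H)$. Then, under the canonical map sending $T_1\otimes\cdots\otimes T_N$ to the operator of that name on $H$, $A$ is the image of exactly one element of $\mathcal L^1(H_1)\otimes\cdots\otimes\mathcal L^1(H_N)$, and, identifying $A$ with that element, $$E(\rho)=\|A\|_\gamma.$$ -/

import Mathlib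

open scoped InnerProductSpace ENNReal TensorProduct
noncomputable section

section TraceClass
variable {K : Type*} [NormedAddCommGroup K] [InnerProductSpace ℂ K] [CompleteSpace K]

/-- The index set of a fixed Hilbert (orthonormal) basis of `K`. -/
def stdIndex (K : Type*) [NormedAddCommGroup K] [InnerProductSpace ℂ K] [CompleteSpace K] :
    Set K := (exists_hilbertBasis ℂ K).choose

/-- A fixed Hilbert (orthonormal) basis of `K`. -/
def stdBasis (K : Type*) [NormedAddCommGroup K] [InnerProductSpace ℂ K] [CompleteSpace K] :
    HilbertBasis (stdIndex K) ℂ K := (exists_hilbertBasis ℂ K).choose_spec.choose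

/-- `trace |T| ∈ [0, ∞]`, where `|T|` is the positive square root of `T* T`. -/
def traceAbs (T : K →L[ℂ] K) : ℝ≥0∞ :=
  ∑' i, ENNReal.ofReal (⟪stdBasis K i, CFC.abs T (stdBasis K i)⟫_ℂ).re

theorem parseval_enorm (x : K) : ∑' j, ‖⟪stdBasis K j, x⟫_ℂ‖ₑ ^ 2 = ‖x‖ₑ ^ 2 := by
  have h := (stdBasis K).hasSum_inner_mul_inner x x
  have h2 : HasSum (fun j => ‖⟪stdBasis K j, x⟫_ℂ‖ ^ 2) (‖x‖ ^ 2) := by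
    have h3 := Complex.hasSum_re h
    convert h3 using 1
    · ext j
      rw [← inner_conj_symm x, Complex.conj_mul']
      norm_cast
    · rw [inner_self_eq_norm_sq_to_K]; norm_cast
  have h4 : ∀ (y : ℝ), 0 ≤ y → ENNReal.ofReal (y ^ 2) = ENNReal.ofReal y ^ 2 := fun y hy =>
    ENNReal.ofReal_pow hy 2
  rw [← ofReal_norm x, ← h4 _ (norm_nonneg _), ← h2.tsum_eq,
    ENNReal.ofReal_tsum_of_nonneg (fun _ => by positivity) h2.summable]
  congr 1; ext j
  rw [h4 _ (norm_nonneg _), ofReal_norm]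

theorem hilbertSchmidt_adjoint (T : K →L[ℂ] K) :
    ∑' i, ‖star T (stdBasis K i)‖ₑ ^ 2 = ∑' i, ‖T (stdBasis K i)‖ₑ ^ 2 := by
  have h : ∀ S : K →L[ℂ] K, ∑' i, ‖S (stdBasis K i)‖ₑ ^ 2 =
      ∑' i, ∑' j, ‖⟪stdBasis K j, S (stdBasis K i)⟫_ℂ‖ₑ ^ 2 := fun S => by
    congr 1; ext i; rw [parseval_enorm]
  rw [h, h, ENNReal.tsum_comm]
  congr 1; ext j; congr 1; ext i
  rw [ContinuousLinearMap.star_eq_adjoint, ContinuousLinearMap.adjoint_inner_right,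
    ← ofReal_norm, norm_inner_symm, ofReal_norm]

theorem exists_sqrt_abs (T : K →L[ℂ] K) :
    ∃ R : K →L[ℂ] K, star R = R ∧ R * R = CFC.abs T := by
  refine ⟨CFC.sqrt (CFC.abs T), (IsSelfAdjoint.of_nonneg (CFC.sqrt_nonneg _)).star_eq, ?_⟩
  exact CFC.sqrt_mul_sqrt_self _ (CFC.abs_nonneg T)

theorem traceAbs_eq {T R : K →L[ℂ] K} (h1 : star R = R) (h2 : R * R = CFC.abs T) :
    traceAbs T = ∑' i, ‖R (stdBasis K i)‖ₑ ^ 2 := by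
  unfold traceAbs
  congr 1; ext i
  rw [← h2, mul_apply_eq_comp]
  nth_rw 1 [← h1]
  rw [ContinuousLinearMap.star_eq_adjoint, ContinuousLinearMap.adjoint_inner_right,
    inner_self_eq_norm_sq_to_K, ← ofReal_norm, ← ENNReal.ofReal_pow (norm_nonneg _)]
  norm_cast

theorem norm_abs_apply (T : K →L[ℂ] K) (x : K) : ‖T x‖ = ‖CFC.abs T x‖ := by
  have h : ⟪T x, T x⟫_ℂ = ⟪CFC.abs T x, CFC.abs T x⟫_ℂ := by
    have hs : star (CFC.abs T) = CFC.abs T := (IsSelfAdjoint.of_nonneg (CFC.abs_nonneg T)).star_eq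
    rw [← ContinuousLinearMap.adjoint_inner_right, ← ContinuousLinearMap.adjoint_inner_right,
      ← ContinuousLinearMap.star_eq_adjoint, ← ContinuousLinearMap.star_eq_adjoint, hs,
      ← mul_apply_eq_comp, ← mul_apply_eq_comp, CFC.abs_mul_abs]
  rw [inner_self_eq_norm_sq_to_K, inner_self_eq_norm_sq_to_K] at h
  have h' : ‖T x‖ ^ 2 = ‖CFC.abs T x‖ ^ 2 := by exact_mod_cast h
  exact (sq_eq_sq₀ (norm_nonneg _) (norm_nonneg _)).1 h'

/-- Polar decomposition: `T = W |T|` and `|T| = W* T` with a contraction `W`. -/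
theorem exists_polar (T : K →L[ℂ] K) :
    ∃ W : K →L[ℂ] K, (∀ x, ‖W x‖ ≤ ‖x‖) ∧ W * CFC.abs T = T ∧ star W * T = CFC.abs T := by
  set P : K →L[ℂ] K := CFC.abs T with hP
  let S : Submodule ℂ K := (LinearMap.range P.toLinearMap).topologicalClosure
  have hS : IsClosed (S : Set K) := Submodule.isClosed_topologicalClosure _
  have : CompleteSpace S := hS.completeSpace_coe
  let e : K →ₗ[ℂ] S := P.toLinearMap.codRestrict S
    (fun x => Submodule.le_topologicalClosure _ (LinearMap.mem_range_self _ x))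
  have hd : DenseRange e := by
    intro y
    rw [closure_subtype]
    have h1 : (Subtype.val '' Set.range e : Set K) = (LinearMap.range P.toLinearMap : Set K) := by
      ext z; constructor
      · rintro ⟨_, ⟨x, rfl⟩, rfl⟩; exact ⟨x, rfl⟩
      · rintro ⟨x, rfl⟩; exact ⟨e x, ⟨x, rfl⟩, rfl⟩
    rw [h1, ← Submodule.topologicalClosure_coe]
    exact y.2
  have hn : ∀ x, ‖T.toLinearMap x‖ ≤ 1 * ‖e x‖ := fun x => by
    rw [one_mul]; exact (norm_abs_apply T x).le
  let W : K →L[ℂ] K := (T.toLinearMap.extendOfNorm e) ∘L S.orthogonalProjectionOnto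
  have hW : ∀ x, ‖W x‖ ≤ ‖x‖ := fun x => by
    calc ‖W x‖ ≤ 1 * ‖S.orthogonalProjectionOnto x‖ :=
          LinearMap.norm_extendOfNorm_apply_le hd 1 hn _
      _ ≤ ‖x‖ := by rw [one_mul]; exact S.norm_orthogonalProjectionOnto_apply_le x
  have hWP : ∀ x, W (P x) = T x := fun x => by
    have h1 : S.orthogonalProjectionOnto (P x) = e x :=
      S.orthogonalProjectionOnto_mem_subspace_eq_self (e x)
    change T.toLinearMap.extendOfNorm e (S.orthogonalProjectionOnto (P x)) = T x
    rw [h1]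
    exact LinearMap.extendOfNorm_eq hd ⟨1, hn⟩ x
  refine ⟨W, hW, ContinuousLinearMap.ext hWP, ContinuousLinearMap.ext fun x => ?_⟩
  have hW' : ‖star W‖ ≤ 1 := by
    rw [norm_star]
    exact ContinuousLinearMap.opNorm_le_bound _ zero_le_one (fun x => by simpa using hW x)
  have h1 : ‖star W (T x)‖ ≤ ‖T x‖ := by
    simpa using (star W).le_of_opNorm_le hW' (T x)
  have h2 : (⟪star W (T x), P x⟫_ℂ).re = ‖T x‖ ^ 2 := by
    rw [ContinuousLinearMap.star_eq_adjoint, ContinuousLinearMap.adjoint_inner_left, hWP,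
      inner_self_eq_norm_sq_to_K]
    norm_cast
  have h3 := norm_sub_sq (𝕜 := ℂ) (star W (T x)) (P x)
  rw [RCLike.re_to_complex, h2, ← norm_abs_apply T x] at h3
  have h4 : ‖star W (T x) - P x‖ = 0 := by
    nlinarith [norm_nonneg (star W (T x) - P x), norm_nonneg (star W (T x)), norm_nonneg (T x)]
  exact sub_eq_zero.1 (norm_eq_zero.1 h4)

theorem tsum_inner_le_traceAbs (T C : K →L[ℂ] K) (hC : ∀ x, ‖C x‖ ≤ ‖x‖) :
    ∑' i, ‖⟪stdBasis K i, C (T (stdBasis K i))⟫_ℂ‖ₑ ≤ traceAbs T := by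
  obtain ⟨W, hW, hWT, -⟩ := exists_polar T
  obtain ⟨R, hR, hRR⟩ := exists_sqrt_abs T
  have key : ∀ x y : ℝ≥0∞, 2 * (x * y) ≤ x ^ 2 + y ^ 2 := by
    intro x y
    rcases eq_or_ne x ⊤ with rfl | hx
    · simp
    rcases eq_or_ne y ⊤ with rfl | hy
    · simp
    lift x to NNReal using hx
    lift y to NNReal using hy
    norm_cast
    rw [← mul_assoc]; exact two_mul_le_add_sq x y
  set D : K →L[ℂ] K := C * W * R with hD
  have h1 : ∀ x, ⟪x, C (T x)⟫_ℂ = ⟪star D x, R x⟫_ℂ := fun x => by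
    rw [ContinuousLinearMap.star_eq_adjoint, ContinuousLinearMap.adjoint_inner_left]
    conv_lhs => rw [← hWT, ← hRR]
    rfl
  have h2 : ∑' i, ‖star D (stdBasis K i)‖ₑ ^ 2 ≤ traceAbs T := by
    rw [hilbertSchmidt_adjoint, traceAbs_eq hR hRR]
    refine ENNReal.tsum_le_tsum fun i => ?_
    gcongr
    rw [enorm_le_iff_norm_le]
    exact (hC _).trans (hW _)
  have h3 : 2 * ∑' i, ‖⟪stdBasis K i, C (T (stdBasis K i))⟫_ℂ‖ₑ ≤ 2 * traceAbs T := by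
    rw [← ENNReal.tsum_mul_left]
    calc _ ≤ ∑' i, (‖star D (stdBasis K i)‖ₑ ^ 2 + ‖R (stdBasis K i)‖ₑ ^ 2) := by
          refine ENNReal.tsum_le_tsum fun i => le_trans ?_ (key _ _)
          gcongr
          rw [h1, ← ofReal_norm, ← ofReal_norm, ← ofReal_norm,
            ← ENNReal.ofReal_mul (norm_nonneg _)]
          exact ENNReal.ofReal_le_ofReal (norm_inner_le_norm _ _)
      _ ≤ traceAbs T + traceAbs T := by
          rw [ENNReal.tsum_add, ← traceAbs_eq hR hRR]
          gcongr
      _ = _ := (two_mul _).symm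
  exact (ENNReal.mul_le_mul_iff_right (by simp) (by simp)).1 h3

theorem traceAbs_le {T W : K →L[ℂ] K} (h : star W * T = CFC.abs T) :
    traceAbs T ≤ ∑' i, ‖⟪stdBasis K i, (star W) (T (stdBasis K i))⟫_ℂ‖ₑ := by
  unfold traceAbs
  refine ENNReal.tsum_le_tsum fun i => ?_
  rw [← h, ← ofReal_norm]
  exact ENNReal.ofReal_le_ofReal (Complex.re_le_norm _)

theorem star_contraction {W : K →L[ℂ] K} (hW : ∀ x, ‖W x‖ ≤ ‖x‖) (x : K) :
    ‖(star W) x‖ ≤ ‖x‖ := by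
  have hW' : ‖star W‖ ≤ 1 := by
    rw [norm_star]
    exact ContinuousLinearMap.opNorm_le_bound _ zero_le_one (fun x => by simpa using hW x)
  simpa using (star W).le_of_opNorm_le hW' x

theorem traceAbs_add_le (S T : K →L[ℂ] K) : traceAbs (S + T) ≤ traceAbs S + traceAbs T := by
  obtain ⟨W, hW, -, hWT⟩ := exists_polar (S + T)
  refine (traceAbs_le hWT).trans ?_
  refine le_trans ?_ (add_le_add (tsum_inner_le_traceAbs S _ (star_contraction hW))
    (tsum_inner_le_traceAbs T _ (star_contraction hW)))
  rw [← ENNReal.tsum_add]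
  refine ENNReal.tsum_le_tsum fun i => ?_
  rw [add_apply, map_add, inner_add_right]
  exact enorm_add_le _ _

theorem traceAbs_smul_le (c : ℂ) (T : K →L[ℂ] K) : traceAbs (c • T) ≤ ‖c‖ₑ * traceAbs T := by
  obtain ⟨W, hW, -, hWT⟩ := exists_polar (c • T)
  refine (traceAbs_le hWT).trans ?_
  grw [← tsum_inner_le_traceAbs T _ (star_contraction hW)]
  rw [← ENNReal.tsum_mul_left]
  refine ENNReal.tsum_le_tsum fun i => ?_
  rw [smul_apply, map_smul, inner_smul_right, enorm_mul]

theorem traceAbs_zero : traceAbs (0 : K →L[ℂ] K) = 0 := by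
  simp [traceAbs]

theorem eq_zero_of_traceAbs {T : K →L[ℂ] K} (h : traceAbs T = 0) : T = 0 := by
  obtain ⟨R, hR, hRR⟩ := exists_sqrt_abs T
  rw [traceAbs_eq hR hRR, ENNReal.tsum_eq_zero] at h
  have hR0 : R = 0 := by
    have h1 : ∑' i, ‖star R (stdBasis K i)‖ₑ ^ 2 = 0 := by
      rw [hR]; exact ENNReal.tsum_eq_zero.2 h
    ext x
    have h2 : ∀ i, R (stdBasis K i) = 0 := fun i => by simpa using h i
    have h3 : ‖R x‖ₑ ^ 2 = 0 := by
      rw [← parseval_enorm, ENNReal.tsum_eq_zero]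
      intro i
      rw [← hR, ContinuousLinearMap.star_eq_adjoint, ContinuousLinearMap.adjoint_inner_right, h2]
      simp
    simpa using h3
  ext x
  have := norm_abs_apply T x
  rw [← hRR, hR0] at this
  simpa using this

/-- The trace class operators on `K`, i.e. the bounded operators `T` with `trace |T| < ∞`, as a
subspace of the bounded operators. -/
def traceClassSubmodule (K : Type*) [NormedAddCommGroup K] [InnerProductSpace ℂ K]
    [CompleteSpace K] : Submodule ℂ (K →L[ℂ] K) where
  carrier := {T | traceAbs T ≠ ⊤}
  add_mem' := fun {S T} hS hT =>
    ne_top_of_le_ne_top (ENNReal.add_ne_top.2 ⟨hS, hT⟩) (traceAbs_add_le S T)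
  zero_mem' := by simp [traceAbs_zero]
  smul_mem' := fun c T hT =>
    ne_top_of_le_ne_top (ENNReal.mul_ne_top enorm_ne_top hT) (traceAbs_smul_le c T)

/-- The space `L¹(K)` of trace class operators on `K`. It is a type of its own, because it carries
the trace norm and not the operator norm. -/
def TraceClass (K : Type*) [NormedAddCommGroup K] [InnerProductSpace ℂ K] [CompleteSpace K] :
    Type _ := traceClassSubmodule K

namespace TraceClass

instance : AddCommGroup (TraceClass K) := inferInstanceAs (AddCommGroup (traceClassSubmodule K))

instance : Module ℂ (TraceClass K) := inferInstanceAs (Module ℂ (traceClassSubmodule K))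

/-- A trace class operator, regarded as a bounded operator. -/
def toOp : TraceClass K →ₗ[ℂ] (K →L[ℂ] K) := (traceClassSubmodule K).subtype

theorem toOp_injective : Function.Injective (toOp : TraceClass K →ₗ[ℂ] (K →L[ℂ] K)) :=
  Subtype.val_injective

theorem traceAbs_toOp_ne_top (T : TraceClass K) : traceAbs (toOp T) ≠ ⊤ := T.2

/-- The trace norm `‖T‖ = trace |T|`. -/
instance : Norm (TraceClass K) := ⟨fun T => (traceAbs (toOp T)).toReal⟩

theorem norm_def (T : TraceClass K) : ‖T‖ = (traceAbs (toOp T)).toReal := rfl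

theorem norm_smul_le' (c : ℂ) (T : TraceClass K) : ‖c • T‖ ≤ ‖c‖ * ‖T‖ := by
  rw [norm_def, norm_def, map_smul, ← toReal_enorm c, ← ENNReal.toReal_mul]
  exact ENNReal.toReal_mono (ENNReal.mul_ne_top enorm_ne_top T.traceAbs_toOp_ne_top)
    (traceAbs_smul_le _ _)

theorem normedSpaceCore : NormedSpace.Core ℂ (TraceClass K) where
  norm_nonneg _ := ENNReal.toReal_nonneg
  norm_smul c T := by
    refine le_antisymm (norm_smul_le' c T) ?_
    rcases eq_or_ne c 0 with rfl | hc
    · rw [norm_zero, zero_mul]; exact ENNReal.toReal_nonneg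
    · have h := norm_smul_le' c⁻¹ (c • T)
      rw [inv_smul_smul₀ hc, norm_inv] at h
      have hc' : 0 < ‖c‖ := norm_pos_iff.2 hc
      rwa [← div_eq_inv_mul, le_div_iff₀ hc', mul_comm] at h
  norm_triangle S T := by
    rw [norm_def, norm_def, norm_def, map_add,
      ← ENNReal.toReal_add S.traceAbs_toOp_ne_top T.traceAbs_toOp_ne_top]
    exact ENNReal.toReal_mono
      (ENNReal.add_ne_top.2 ⟨S.traceAbs_toOp_ne_top, T.traceAbs_toOp_ne_top⟩)
      (traceAbs_add_le _ _)
  norm_eq_zero_iff T := by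
    rw [norm_def, ENNReal.toReal_eq_zero_iff, or_iff_left T.traceAbs_toOp_ne_top]
    constructor
    · intro h
      exact toOp_injective (by rw [eq_zero_of_traceAbs h, map_zero])
    · rintro rfl
      rw [map_zero, traceAbs_zero]

instance : NormedAddCommGroup (TraceClass K) := NormedAddCommGroup.ofCore normedSpaceCore

instance : NormedSpace ℂ (TraceClass K) := NormedSpace.ofCore normedSpaceCore

end TraceClass

/-- The trace of an operator, `trace T = ∑ᵢ ⟨T eᵢ, eᵢ⟩` along a Hilbert basis. It is used only for
trace class operators, for which the sum converges absolutely. -/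
def opTrace (T : K →L[ℂ] K) : ℂ := ∑' i, ⟪stdBasis K i, T (stdBasis K i)⟫_ℂ

end TraceClass

section HilbertTensor

open scoped TensorProduct ComplexOrder
open PiTensorProduct

variable {N : ℕ} (H : Fin N → Type*) [∀ k, NormedAddCommGroup (H k)]
  [∀ k, InnerProductSpace ℂ (H k)]

/-- The algebraic tensor product of the Hilbert spaces `H k`, as a type that carries
the norm of the inner product `⟨⊗ xₖ, ⊗ yₖ⟩ = ∏ ⟨xₖ, yₖ⟩`. -/
def AlgTensor : Type _ := ⨂[ℂ] k, H k

namespace AlgTensor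

instance : AddCommGroup (AlgTensor H) := inferInstanceAs (AddCommGroup (⨂[ℂ] k, H k))

instance : Module ℂ (AlgTensor H) := inferInstanceAs (Module ℂ (⨂[ℂ] k, H k))

/-- The elementary tensors. -/
def mk : MultilinearMap ℂ H (AlgTensor H) := PiTensorProduct.tprod ℂ

variable {H}

theorem span_mk : Submodule.span ℂ (Set.range (mk H)) = ⊤ := PiTensorProduct.span_tprod_eq_top

theorem exists_sum (z : AlgTensor H) :
    ∃ (n : ℕ) (a : Fin n → ℂ) (x : Fin n → ∀ k, H k), z = ∑ i, a i • mk H (x i) := by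
  have hz : z ∈ Submodule.span ℂ (Set.range (mk H)) := by rw [span_mk]; trivial
  obtain ⟨n, a, g, h⟩ := Submodule.mem_span_set'.1 hz
  choose x hx using fun i => (g i).2
  exact ⟨n, a, x, by simp_rw [hx]; exact h.symm⟩

/-- The multilinear map `y ↦ ∏ₖ ⟨xₖ, yₖ⟩`. -/
def prodInner (x : ∀ k, H k) : MultilinearMap ℂ H ℂ :=
  (MultilinearMap.mkPiAlgebra ℂ (Fin N) ℂ).compLinearMap fun k => (innerₛₗ ℂ (x k))

theorem prodInner_apply (x y : ∀ k, H k) : prodInner x y = ∏ k, ⟪x k, y k⟫_ℂ := by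
  simp [prodInner]

/-- The conjugate linear functional `⊗ xₖ ↦ ∏ₖ ⟨xₖ, yₖ⟩`. -/
def innerRight (y : ∀ k, H k) : AlgTensor H →ₗ⋆[ℂ] ℂ :=
  (starLinearEquiv ℂ (A := ℂ)).toLinearMap.comp
    (show AlgTensor H →ₗ[ℂ] ℂ from PiTensorProduct.lift (prodInner y))

theorem innerRight_mk (x y : ∀ k, H k) : innerRight y (mk H x) = ∏ k, ⟪x k, y k⟫_ℂ := by
  change star (PiTensorProduct.lift (prodInner y) (PiTensorProduct.tprod ℂ x)) = _
  rw [PiTensorProduct.lift.tprod, prodInner_apply, star_prod]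
  simp

theorem ext_conj {f g : AlgTensor H →ₗ⋆[ℂ] ℂ} (h : ∀ x, f (mk H x) = g (mk H x)) : f = g := by
  ext z
  obtain ⟨n, a, x, rfl⟩ := exists_sum z
  simp [h]

/-- The linear map `w ↦ (z ↦ ⟨z, w⟩)`. -/
def sesq : AlgTensor H →ₗ[ℂ] (AlgTensor H →ₗ⋆[ℂ] ℂ) :=
  show (⨂[ℂ] k, H k) →ₗ[ℂ] (AlgTensor H →ₗ⋆[ℂ] ℂ) from PiTensorProduct.lift
  { toFun := innerRight
    map_update_add' := by
      intro _ y k u v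
      refine ext_conj fun x => ?_
      simp only [LinearMap.add_apply, innerRight_mk, ← prodInner_apply]
      exact (prodInner x).map_update_add y k u v
    map_update_smul' := by
      intro _ y k c u
      refine ext_conj fun x => ?_
      simp only [LinearMap.smul_apply, innerRight_mk, ← prodInner_apply]
      exact (prodInner x).map_update_smul y k c u }

theorem sesq_mk (x y : ∀ k, H k) : sesq (mk H y) (mk H x) = ∏ k, ⟪x k, y k⟫_ℂ := by
  rw [← innerRight_mk]
  exact congrArg (fun f : AlgTensor H →ₗ⋆[ℂ] ℂ => f (mk H x))
    (PiTensorProduct.lift.tprod (R := ℂ) (s := H) y)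

/-- The Gram matrix of a finite family of elementary tensors. -/
def gramMk {n : ℕ} (x : Fin n → ∀ k, H k) : Matrix (Fin n) (Fin n) ℂ :=
  Matrix.of fun i j => ∏ k, ⟪x i k, x j k⟫_ℂ

theorem sesq_sum {n : ℕ} (a : Fin n → ℂ) (x : Fin n → ∀ k, H k) :
    sesq (∑ i, a i • mk H (x i)) (∑ i, a i • mk H (x i)) = star a ⬝ᵥ (gramMk x).mulVec a := by
  simp only [map_sum, map_smul, LinearMap.sum_apply, LinearMap.smul_apply,
    map_smulₛₗ, sesq_mk, dotProduct, Matrix.mulVec, gramMk, Matrix.of_apply, Finset.mul_sum,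
    smul_eq_mul, Pi.star_apply]
  refine Finset.sum_congr rfl fun i _ => Finset.sum_congr rfl fun j _ => ?_
  rw [starRingEnd_apply]; ring

theorem posSemidef_prod_gram {n : ℕ} (x : Fin n → ∀ k, H k) (s : Finset (Fin N)) :
    (Matrix.of fun i j => ∏ k ∈ s, ⟪x i k, x j k⟫_ℂ).PosSemidef := by
  induction s using Finset.induction_on with
  | empty =>
    have h : (Matrix.of fun i j => ∏ k ∈ ∅, ⟪x i k, x j k⟫_ℂ) =
        Matrix.gram ℂ (fun _ : Fin n => (1 : ℂ)) := by
      ext i j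
      simp
    rw [h]
    exact Matrix.posSemidef_gram ℂ _
  | insert k s hk ih =>
    have h : (Matrix.of fun i j => ∏ k ∈ insert k s, ⟪x i k, x j k⟫_ℂ) =
        (Matrix.gram ℂ (fun i => x i k)).hadamard
          (Matrix.of fun i j => ∏ k ∈ s, ⟪x i k, x j k⟫_ℂ) := by
      ext i j
      simp [Finset.prod_insert hk]
    rw [h]
    exact (Matrix.posSemidef_gram ℂ (fun i => x i k)).hadamard ih

theorem posSemidef_prod_gram_sub {n : ℕ} (T : ∀ k, H k →L[ℂ] H k) (x : Fin n → ∀ k, H k)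
    (s : Finset (Fin N)) :
    (Matrix.of fun i j => (((∏ k ∈ s, ‖T k‖) ^ 2 : ℝ) : ℂ) * ∏ k ∈ s, ⟪x i k, x j k⟫_ℂ -
      ∏ k ∈ s, ⟪T k (x i k), T k (x j k)⟫_ℂ).PosSemidef := by
  induction s using Finset.induction_on with
  | empty =>
    have h : (Matrix.of fun i j => (((∏ k ∈ ∅, ‖T k‖) ^ 2 : ℝ) : ℂ) * ∏ k ∈ ∅, ⟪x i k, x j k⟫_ℂ -
        ∏ k ∈ ∅, ⟪T k (x i k), T k (x j k)⟫_ℂ) = 0 := by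
      ext i j
      simp
    rw [h]
    exact Matrix.PosSemidef.zero
  | insert k s hk ih =>
    have h1 := (Matrix.posSemidef_gram ℂ (fun i => T k (x i k))).hadamard ih
    have h2 := (Matrix.posSemidef_opNorm_smul_gram_sub_gram (𝕜 := ℂ)
      (fun i => x i k) (T k)).hadamard (posSemidef_prod_gram x s)
    have h3 := h2.smul (a := ((∏ k ∈ s, ‖T k‖) ^ 2 : ℝ)) (by positivity)
    refine cast (congrArg (fun M : Matrix (Fin n) (Fin n) ℂ => M.PosSemidef) ?_) (h1.add h3)
    ext i j
    simp only [Matrix.of_apply, Matrix.add_apply, Matrix.hadamard_apply, Matrix.smul_apply,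
      Matrix.sub_apply, Matrix.gram_apply, Finset.prod_insert hk, Function.comp_apply,
      Complex.real_smul]
    push_cast
    ring

theorem gramMk_posSemidef {n : ℕ} (x : Fin n → ∀ k, H k) : (gramMk x).PosSemidef :=
  posSemidef_prod_gram x Finset.univ

/-- The inner product on the algebraic tensor product, `⟨⊗ xₖ, ⊗ yₖ⟩ = ∏ ⟨xₖ, yₖ⟩`. -/
@[reducible]
def preCore : PreInnerProductSpace.Core ℂ (AlgTensor H) where
  inner z w := sesq w z
  conj_inner_symm z w := by
    obtain ⟨n, a, x, rfl⟩ := exists_sum z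
    obtain ⟨m, b, y, rfl⟩ := exists_sum w
    simp only [map_sum, map_smul, LinearMap.sum_apply, LinearMap.smul_apply,
      map_smulₛₗ, sesq_mk, smul_eq_mul, Finset.mul_sum, map_mul, map_prod, inner_conj_symm,
      Complex.conj_conj]
    rw [Finset.sum_comm]
    exact Finset.sum_congr rfl fun i _ => Finset.sum_congr rfl fun j _ => by ring
  re_inner_nonneg z := by
    obtain ⟨n, a, x, rfl⟩ := exists_sum z
    rw [sesq_sum]
    exact (Complex.nonneg_iff.1 ((gramMk_posSemidef x).dotProduct_mulVec_nonneg a)).1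
  add_left z z' w := by simp
  smul_left z w c := by simp

instance : SeminormedAddCommGroup (AlgTensor H) :=
  @InnerProductSpace.Core.toSeminormedAddCommGroup ℂ (AlgTensor H) _ _ _ preCore

instance : InnerProductSpace ℂ (AlgTensor H) := InnerProductSpace.ofCore preCore

theorem inner_def (z w : AlgTensor H) : ⟪z, w⟫_ℂ = sesq w z := rfl

theorem inner_mk_mk (x y : ∀ k, H k) :
    ⟪mk H x, mk H y⟫_ℂ = ∏ k, ⟪x k, y k⟫_ℂ := sesq_mk x y

/-- `⊗ xₖ ↦ ⊗ Tₖ xₖ` as a linear map. -/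
def mapLin (T : ∀ k, H k →L[ℂ] H k) : AlgTensor H →ₗ[ℂ] AlgTensor H :=
  show (⨂[ℂ] k, H k) →ₗ[ℂ] (⨂[ℂ] k, H k) from PiTensorProduct.map fun k => (T k).toLinearMap

theorem mapLin_mk (T : ∀ k, H k →L[ℂ] H k) (x : ∀ k, H k) :
    mapLin T (mk H x) = mk H fun k => T k (x k) :=
  PiTensorProduct.map_tprod (R := ℂ) (fun k => (T k).toLinearMap) x

theorem norm_mapLin_le (T : ∀ k, H k →L[ℂ] H k) (z : AlgTensor H) :
    ‖mapLin T z‖ ≤ (∏ k, ‖T k‖) * ‖z‖ := by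
  obtain ⟨n, a, x, rfl⟩ := exists_sum z
  have h := ((posSemidef_prod_gram_sub T x Finset.univ).dotProduct_mulVec_nonneg a)
  have h1 : (Matrix.of fun i j => (((∏ k, ‖T k‖) ^ 2 : ℝ) : ℂ) * ∏ k, ⟪x i k, x j k⟫_ℂ -
      ∏ k, ⟪T k (x i k), T k (x j k)⟫_ℂ) =
      (((∏ k, ‖T k‖) ^ 2 : ℝ) : ℂ) • gramMk x - gramMk (fun i k => T k (x i k)) := by
    ext i j; simp [gramMk]
  rw [h1, Matrix.sub_mulVec, dotProduct_sub, Matrix.smul_mulVec, dotProduct_smul,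
    ← sesq_sum, ← sesq_sum] at h
  have h2 : mapLin T (∑ i, a i • mk H (x i)) = ∑ i, a i • mk H fun k => T k (x i k) := by
    simp [mapLin_mk]
  rw [← h2, ← inner_def, ← inner_def] at h
  set z := ∑ i, a i • mk H (x i)
  have h3 := (Complex.nonneg_iff.1 h).1
  change 0 ≤ ((((∏ k, ‖T k‖) ^ 2 : ℝ) : ℂ) • ⟪z, z⟫_ℂ - ⟪mapLin T z, mapLin T z⟫_ℂ).re at h3
  have hsq : ∀ w : AlgTensor H, ⟪w, w⟫_ℂ = ((‖w‖ ^ 2 : ℝ) : ℂ) := fun w => by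
    rw [inner_self_eq_norm_sq_to_K]; norm_cast
  rw [hsq, hsq, smul_eq_mul, ← Complex.ofReal_mul, ← Complex.ofReal_sub, Complex.ofReal_re] at h3
  have h4 : ‖mapLin T z‖ ^ 2 ≤ ((∏ k, ‖T k‖) * ‖z‖) ^ 2 := by
    rw [mul_pow]
    linarith
  exact (sq_le_sq₀ (norm_nonneg _) (by positivity)).1 h4

end AlgTensor

/-- The Hilbert space tensor product `H₁ ⊗ ⋯ ⊗ H_N`: the completion of the algebraic tensor
product for the inner product `⟨⊗ xₖ, ⊗ yₖ⟩ = ∏ ⟨xₖ, yₖ⟩`. -/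
abbrev HilbertTensor : Type _ := UniformSpace.Completion (AlgTensor H)

variable {H}

/-- The product vector `x₁ ⊗ ⋯ ⊗ x_N`. -/
def tensorVec (x : ∀ k, H k) : HilbertTensor H := (AlgTensor.mk H x : AlgTensor H)

theorem inner_tensorVec (x y : ∀ k, H k) :
    ⟪tensorVec x, tensorVec y⟫_ℂ = ∏ k, ⟪x k, y k⟫_ℂ := by
  rw [tensorVec, tensorVec, UniformSpace.Completion.inner_coe, AlgTensor.inner_mk_mk]

/-- Two bounded operators that agree on product vectors are equal. -/
theorem ext_tensorVec {S T : HilbertTensor H →L[ℂ] HilbertTensor H}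
    (h : ∀ x : ∀ k, H k, S (tensorVec x) = T (tensorVec x)) : S = T := by
  ext z
  induction z using UniformSpace.Completion.induction_on with
  | hp => exact isClosed_eq S.continuous T.continuous
  | ih z =>
    obtain ⟨n, a, x, rfl⟩ := AlgTensor.exists_sum z
    have h1 : ((∑ i, a i • AlgTensor.mk H (x i) : AlgTensor H) : HilbertTensor H) =
        ∑ i, a i • tensorVec (x i) := by
      change UniformSpace.Completion.toComplL (𝕜 := ℂ) _ = _
      rw [map_sum]
      refine Finset.sum_congr rfl fun i _ => ?_
      rw [map_smul]; rfl
    rw [h1]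
    simp [h]

/-- The bounded operator `T₁ ⊗ ⋯ ⊗ T_N` on `H₁ ⊗ ⋯ ⊗ H_N`. -/
def tensorOpFun (T : ∀ k, H k →L[ℂ] H k) : HilbertTensor H →L[ℂ] HilbertTensor H :=
  (UniformSpace.Completion.toComplL.comp
    ((AlgTensor.mapLin T).mkContinuous (∏ k, ‖T k‖) (AlgTensor.norm_mapLin_le T))).extend
    UniformSpace.Completion.toComplL

theorem tensorOpFun_apply (T : ∀ k, H k →L[ℂ] H k) (x : ∀ k, H k) :
    tensorOpFun T (tensorVec x) = tensorVec fun k => T k (x k) := by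
  have h := ContinuousLinearMap.extend_eq (UniformSpace.Completion.toComplL.comp
    ((AlgTensor.mapLin T).mkContinuous (∏ k, ‖T k‖) (AlgTensor.norm_mapLin_le T)))
    (e := (UniformSpace.Completion.toComplL : AlgTensor H →L[ℂ] HilbertTensor H))
    (UniformSpace.Completion.denseRange_coe)
    (UniformSpace.Completion.isUniformInducing_coe _) (AlgTensor.mk H x)
  refine h.trans ?_
  change ((AlgTensor.mapLin T (AlgTensor.mk H x) : AlgTensor H) : HilbertTensor H) = _
  rw [AlgTensor.mapLin_mk]
  rfl

theorem tensorVec_multilinear : ∃ f : MultilinearMap ℂ H (HilbertTensor H),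
    ∀ x, f x = tensorVec x :=
  ⟨UniformSpace.Completion.toComplL.toLinearMap.compMultilinearMap (AlgTensor.mk H), fun _ => rfl⟩

/-- The operator `T₁ ⊗ ⋯ ⊗ T_N`, as a multilinear map of `(T₁, …, T_N)`. -/
def tensorOp : MultilinearMap ℂ (fun k => H k →L[ℂ] H k)
    (HilbertTensor H →L[ℂ] HilbertTensor H) where
  toFun := tensorOpFun
  map_update_add' := by
    intro _ T k A B
    obtain ⟨f, hf⟩ := tensorVec_multilinear (H := H)
    refine ext_tensorVec fun x => ?_
    have h : ∀ C : H k →L[ℂ] H k, (fun j => Function.update T k C j (x j)) =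
        Function.update (fun j => T j (x j)) k (C (x k)) := by
      intro C; ext j
      rcases eq_or_ne j k with rfl | hj
      · simp
      · simp [hj]
    rw [add_apply, tensorOpFun_apply, tensorOpFun_apply, tensorOpFun_apply, h, h, h, ← hf, ← hf,
      ← hf, add_apply, f.map_update_add]
  map_update_smul' := by
    intro _ T k c A
    obtain ⟨f, hf⟩ := tensorVec_multilinear (H := H)
    refine ext_tensorVec fun x => ?_
    have h : ∀ C : H k →L[ℂ] H k, (fun j => Function.update T k C j (x j)) =
        Function.update (fun j => T j (x j)) k (C (x k)) := by
      intro C; ext j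
      rcases eq_or_ne j k with rfl | hj
      · simp
      · simp [hj]
    rw [smul_apply, tensorOpFun_apply, tensorOpFun_apply, h, h, ← hf, ← hf,
      smul_apply, f.map_update_smul]

theorem tensorOp_apply (T : ∀ k, H k →L[ℂ] H k) (x : ∀ k, H k) :
    tensorOp T (tensorVec x) = tensorVec fun k => T k (x k) := tensorOpFun_apply T x

/-- The canonical map from the tensor product of the trace class spaces `L¹(H k)` to the bounded
operators on `H₁ ⊗ ⋯ ⊗ H_N`, which sends `T₁ ⊗ ⋯ ⊗ T_N` to the operator of that name. -/
def tensorToOp [∀ k, CompleteSpace (H k)] :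
    (⨂[ℂ] k, TraceClass (H k)) →ₗ[ℂ] (HilbertTensor H →L[ℂ] HilbertTensor H) :=
  PiTensorProduct.lift (tensorOp.compLinearMap fun _ => TraceClass.toOp)

variable (H) in
/-- The set of decomposable unit vectors `ξ₁ ⊗ ⋯ ⊗ ξ_N` with `‖ξₖ‖ = 1`. -/
def productVectors : Set (HilbertTensor H) :=
  {v | ∃ ξ : ∀ k, H k, (∀ k, ‖ξ k‖ = 1) ∧ v = tensorVec ξ}

end HilbertTensor

section Entanglement

variable {K : Type*} [NormedAddCommGroup K] [InnerProductSpace ℂ K]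

/-- `‖X‖_V = sup {|⟨X ξ, η⟩| : ξ, η ∈ V}`. -/
def opNormOn (V : Set K) (X : K →L[ℂ] K) : ℝ≥0∞ := ⨆ ξ ∈ V, ⨆ η ∈ V, ‖⟪η, X ξ⟫_ℂ‖ₑ

/-- The test operators: the C*-algebra `{C + c 1 : C compact, c ∈ ℂ}`. -/
def testOperators (K : Type*) [NormedAddCommGroup K] [InnerProductSpace ℂ K] :
    Set (K →L[ℂ] K) :=
  {X | ∃ (C : K →L[ℂ] K) (c : ℂ), IsCompactOperator C ∧ X = C + c • ContinuousLinearMap.id ℂ K}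

/-- The entanglement function
`E(ρ) = sup {|ρ(X)| : X a test operator with ‖X‖_V ≤ 1} ∈ [0, ∞]`
of a linear functional `ρ` on the bounded operators. -/
def entanglement (V : Set K) (ρ : (K →L[ℂ] K) →ₗ[ℂ] ℂ) : ℝ≥0∞ :=
  ⨆ X ∈ {X ∈ testOperators K | opNormOn V X ≤ 1}, ‖ρ X‖ₑ

/-- Normal states of `B(K)`: positive linear functionals with value `1` at the identity that
preserve the suprema of increasing nets (upward directed sets) of positive operators. -/
structure IsNormalState [CompleteSpace K] (ρ : (K →L[ℂ] K) →ₗ[ℂ] ℂ) : Prop where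
  nonneg : ∀ X : K →L[ℂ] K, 0 ≤ X → 0 ≤ (ρ X).re ∧ (ρ X).im = 0
  map_one : ρ 1 = 1
  normal : ∀ (D : Set (K →L[ℂ] K)) (S : K →L[ℂ] K), (∀ X ∈ D, 0 ≤ X) → D.Nonempty →
    DirectedOn (· ≤ ·) D → IsLUB D S → IsLUB ((fun X => (ρ X).re) '' D) (ρ S).re

/-- `A` is the density operator of `ρ`: `ρ(X) = trace (A X)` for all bounded `X`. -/
def HasDensity [CompleteSpace K] (ρ : (K →L[ℂ] K) →ₗ[ℂ] ℂ) (A : TraceClass K) : Prop :=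
  ∀ X : K →L[ℂ] K, ρ X = opTrace (TraceClass.toOp A * X)

end Entanglement
end

open scoped InnerProductSpace ENNReal TensorProduct
open Filter Topology ContinuousLinearMap InnerProductSpace

noncomputable section

/-! ### Hilbert–Schmidt norms and the ideal property of the trace norm -/

section HilbertSchmidt

/-! Only the factor at `k₀` may be infinite-dimensional. Bases of the other factors therefore turn
an operator on the tensor product into a finite block matrix of operators on `H k₀`. Blocks of a
trace class operator are trace class, and finitely many trace class blocks assemble to a trace class
operator. So the canonical map is a bijection `Φ` from the algebraic tensor product onto the trace
class operators of `HilbertTensor H` (`bijective_tensorToTraceClass`), which gives existence and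
uniqueness of the tensor.

The equality of norms is a duality between the projective norm and `‖·‖_V`. A bounded operator `X`
defines the multilinear form `(T₁, …, T_N) ↦ trace ((T₁ ⊗ ⋯ ⊗ T_N) X)`, whose values on rank one
operators are the matrix entries of `X` between product vectors. Hence `‖X‖_V ≤ 1` bounds the form
on rank one operators, and a functional on a trace class space is controlled by these: extending one
variable at a time (`TraceClass.norm_multilinear_le_of_dyad`) gives norm at most `1` on all trace
class operators. The universal property of the projective norm then yields `|ρ(X)| ≤ ‖z‖`
(`norm_pairing_tensor_le`).

Conversely, Hahn–Banach gives a functional `g` with `‖g‖ ≤ 1` and `g z = ‖z‖`. It need not come from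
a test operator, but its compression by finite rank projections in every factor is the pairing with
a finite rank operator (`pairing_dualOp`), whose `V`-norm is again at most `1`
(`opNormOn_dualOp_le`). The compressions of `z` converge to `z` in the projective norm
(`tendsto_mapL_compress`), so these operators attain `‖z‖` in the limit. -/

theorem enorm_inner_le {K : Type*} [NormedAddCommGroup K] [InnerProductSpace ℂ K] (x y : K) :
    ‖⟪x, y⟫_ℂ‖ₑ ≤ ‖x‖ₑ * ‖y‖ₑ := by
  rw [← ofReal_norm, ← ofReal_norm, ← ofReal_norm, ← ENNReal.ofReal_mul (norm_nonneg _)]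
  exact ENNReal.ofReal_le_ofReal (norm_inner_le_norm _ _)

theorem enorm_le_one_of_contraction {K L : Type*} [NormedAddCommGroup K] [InnerProductSpace ℂ K]
    [NormedAddCommGroup L] [InnerProductSpace ℂ L] {W : K →L[ℂ] L} (hW : ∀ x, ‖W x‖ ≤ ‖x‖) :
    ‖W‖ₑ ≤ 1 := by
  rw [← ofReal_norm, ← ENNReal.ofReal_one]
  exact ENNReal.ofReal_le_ofReal
    (opNorm_le_bound _ zero_le_one fun x => by simpa using hW x)

theorem ENNReal.tsum_mul_le_sqrt_mul_sqrt {ι : Type*} (f g : ι → ℝ≥0∞) :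
    ∑' i, f i * g i ≤ (∑' i, f i ^ 2) ^ (1 / 2 : ℝ) * (∑' i, g i ^ 2) ^ (1 / 2 : ℝ) := by
  rw [ENNReal.tsum_eq_iSup_sum]
  refine iSup_le fun s => ?_
  refine (ENNReal.inner_le_Lp_mul_Lq s f g Real.HolderConjugate.two_two).trans ?_
  simp only [ENNReal.rpow_ofNat]
  gcongr <;> exact ENNReal.sum_le_tsum s

variable {K L M : Type*} [NormedAddCommGroup K] [InnerProductSpace ℂ K] [CompleteSpace K]
  [NormedAddCommGroup L] [InnerProductSpace ℂ L] [CompleteSpace L]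
  [NormedAddCommGroup M] [InnerProductSpace ℂ M] [CompleteSpace M]

/-- The square of the Hilbert–Schmidt norm. -/
def hsSq (S : K →L[ℂ] L) : ℝ≥0∞ := ∑' i, ‖S (stdBasis K i)‖ₑ ^ 2

theorem enorm_adjoint (C : K →L[ℂ] L) : ‖adjoint C‖ₑ = ‖C‖ₑ := by
  rw [← ofReal_norm, LinearIsometryEquiv.norm_map, ofReal_norm]

theorem hsSq_adjoint (S : K →L[ℂ] L) : hsSq (adjoint S) = hsSq S := by
  have h1 : hsSq S = ∑' i, ∑' j, ‖⟪stdBasis L j, S (stdBasis K i)⟫_ℂ‖ₑ ^ 2 := by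
    unfold hsSq; congr 1; ext i; rw [parseval_enorm]
  have h2 : hsSq (adjoint S) = ∑' j, ∑' i,
      ‖⟪stdBasis K i, adjoint S (stdBasis L j)⟫_ℂ‖ₑ ^ 2 := by
    unfold hsSq; congr 1; ext i; rw [parseval_enorm]
  rw [h1, h2, ENNReal.tsum_comm]
  congr 1; ext i; congr 1; ext j
  rw [adjoint_inner_right, ← ofReal_norm, norm_inner_symm, ofReal_norm]

omit [CompleteSpace L] [CompleteSpace M] in
theorem hsSq_comp_le_left (C : L →L[ℂ] M) (S : K →L[ℂ] L) :
    hsSq (C ∘L S) ≤ ‖C‖ₑ ^ 2 * hsSq S := by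
  unfold hsSq
  rw [← ENNReal.tsum_mul_left]
  refine ENNReal.tsum_le_tsum fun i => ?_
  rw [← mul_pow]
  gcongr
  exact C.le_opENorm _

theorem hsSq_comp_le_right (S : L →L[ℂ] M) (C : K →L[ℂ] L) :
    hsSq (S ∘L C) ≤ ‖C‖ₑ ^ 2 * hsSq S := by
  rw [← hsSq_adjoint, adjoint_comp, ← hsSq_adjoint S, ← enorm_adjoint]
  exact hsSq_comp_le_left _ _

/-- With the polar contraction `W` of `ST`, the trace of `|ST|` is at most `∑ |⟨S* W eᵢ, T eᵢ⟩|`.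
Cauchy–Schwarz separates the factors, and `S* W` has no larger Hilbert–Schmidt norm than `S`. -/
theorem traceAbs_comp_le (S : L →L[ℂ] K) (T : K →L[ℂ] L) :
    traceAbs (S ∘L T) ≤ hsSq S ^ (1 / 2 : ℝ) * hsSq T ^ (1 / 2 : ℝ) := by
  obtain ⟨W, hW, -, hWT⟩ := exists_polar (S ∘L T)
  have h1 : hsSq (adjoint S ∘L W) ≤ hsSq S := by
    refine (hsSq_comp_le_right _ _).trans ?_
    grw [enorm_le_one_of_contraction hW, hsSq_adjoint]
    simp
  refine (traceAbs_le hWT).trans ?_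
  calc _ ≤ ∑' i, ‖(adjoint S ∘L W) (stdBasis K i)‖ₑ * ‖T (stdBasis K i)‖ₑ := by
        refine ENNReal.tsum_le_tsum fun i => ?_
        rw [star_eq_adjoint, adjoint_inner_right, comp_apply, ← adjoint_inner_left]
        exact enorm_inner_le _ _
    _ ≤ hsSq (adjoint S ∘L W) ^ (1 / 2 : ℝ) * hsSq T ^ (1 / 2 : ℝ) :=
        ENNReal.tsum_mul_le_sqrt_mul_sqrt _ _
    _ ≤ _ := by gcongr

/-- An operator is a product of two operators whose squared Hilbert–Schmidt norms are at most its
trace norm. -/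
theorem exists_hsSq_factor (T : K →L[ℂ] K) : ∃ S R : K →L[ℂ] K, S ∘L R = T ∧
    hsSq S ≤ traceAbs T ∧ hsSq R ≤ traceAbs T := by
  obtain ⟨W, hW, hWT, -⟩ := exists_polar T
  obtain ⟨R, hR, hRR⟩ := exists_sqrt_abs T
  have hRT : hsSq R = traceAbs T := (traceAbs_eq hR hRR).symm
  -- `R` is the square root of `|T|`, so the polar decomposition reads `T = W |T| = (W R) R`.
  refine ⟨W ∘L R, R, ?_, ?_, hRT.le⟩
  · rw [comp_assoc]
    exact (congrArg (W * ·) hRR).trans hWT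
  · refine (hsSq_comp_le_left _ _).trans ?_
    grw [enorm_le_one_of_contraction hW, hRT]
    simp

/-- Splitting `T = S R` into Hilbert–Schmidt factors lets `C` be absorbed on the left of `S` and `D`
on the right of `R`. This also covers operators between different spaces, as needed for blocks. -/
theorem traceAbs_conj_le (C : K →L[ℂ] L) (T : K →L[ℂ] K) (D : L →L[ℂ] K) :
    traceAbs (C ∘L T ∘L D) ≤ ‖C‖ₑ * ‖D‖ₑ * traceAbs T := by
  obtain ⟨S, R, rfl, hS, hR⟩ := exists_hsSq_factor T
  rw [show C ∘L (S ∘L R) ∘L D = (C ∘L S) ∘L (R ∘L D) from rfl]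
  refine (traceAbs_comp_le _ _).trans ?_
  grw [hsSq_comp_le_left, hsSq_comp_le_right, hS, hR]
  have hsq : ∀ x : ℝ≥0∞, (x ^ 2) ^ (1 / 2 : ℝ) = x := fun x => by
    rw [← ENNReal.rpow_natCast, ← ENNReal.rpow_mul]; norm_num
  rw [← ENNReal.mul_rpow_of_nonneg _ _ (by norm_num),
    show ‖C‖ₑ ^ 2 * traceAbs (S ∘L R) * (‖D‖ₑ ^ 2 * traceAbs (S ∘L R)) =
      (‖C‖ₑ * ‖D‖ₑ * traceAbs (S ∘L R)) ^ 2 by ring, hsq]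

/-- A rank one operator factors through `ℂ`, and the two factors have Hilbert–Schmidt norms `‖x‖`
and `‖y‖`. -/
theorem traceAbs_rankOne_le (x y : K) : traceAbs (rankOne ℂ x y) ≤ ‖x‖ₑ * ‖y‖ₑ := by
  have hsq : ∀ x : ℝ≥0∞, (x ^ 2) ^ (1 / 2 : ℝ) = x := fun x => by
    rw [← ENNReal.rpow_natCast, ← ENNReal.rpow_mul]; norm_num
  have h1 : ∀ z : K, hsSq (innerSL ℂ z) = ‖z‖ₑ ^ 2 := fun z => by
    rw [← parseval_enorm]
    unfold hsSq
    congr 1; ext i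
    rw [innerSL_apply_apply, ← ofReal_norm, norm_inner_symm, ofReal_norm]
  have h2 : hsSq (toSpanSingleton ℂ x) = ‖x‖ₑ ^ 2 := by
    rw [← h1, ← hsSq_adjoint]
    congr 1
    ext z
    refine ext_inner_left ℂ fun c => ?_
    rw [adjoint_inner_right]
    simp [inner_smul_left, mul_comm]
  rw [rankOne_def']
  refine (traceAbs_comp_le _ _).trans ?_
  rw [h1, h2, hsq, hsq]

end HilbertSchmidt

/-! ### Two-sided multiplication, rank one operators and the trace pairing -/

namespace TraceClass

variable {K L : Type*} [NormedAddCommGroup K] [InnerProductSpace ℂ K] [CompleteSpace K]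
  [NormedAddCommGroup L] [InnerProductSpace ℂ L] [CompleteSpace L]

/-- The trace class operator with underlying bounded operator `T`. -/
def ofOp (T : K →L[ℂ] K) (hT : traceAbs T ≠ ⊤) : TraceClass K := ⟨T, hT⟩

theorem toOp_ofOp (T : K →L[ℂ] K) (hT : traceAbs T ≠ ⊤) : toOp (ofOp T hT) = T := rfl

theorem enorm_eq (T : TraceClass K) : ‖T‖ₑ = traceAbs (toOp T) := by
  rw [← ofReal_norm, norm_def, ENNReal.ofReal_toReal T.traceAbs_toOp_ne_top]

theorem norm_le_of_traceAbs_le {T : TraceClass K} {r : ℝ} (hr : 0 ≤ r)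
    (h : traceAbs (toOp T) ≤ ENNReal.ofReal r) : ‖T‖ ≤ r :=
  ENNReal.toReal_le_of_le_ofReal hr h

theorem traceAbs_conj_toOp_le (C : K →L[ℂ] L) (D : L →L[ℂ] K) (T : TraceClass K) :
    traceAbs (C ∘L toOp T ∘L D) ≤ ENNReal.ofReal (‖C‖ * ‖D‖ * ‖T‖) := by
  rw [ENNReal.ofReal_mul (by positivity), ENNReal.ofReal_mul (by positivity), ofReal_norm,
    ofReal_norm, ofReal_norm, enorm_eq]
  exact traceAbs_conj_le C (toOp T) D

/-- `T ↦ C T D` as a linear map of trace class operators. -/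
def conjLin (C : K →L[ℂ] L) (D : L →L[ℂ] K) : TraceClass K →ₗ[ℂ] TraceClass L where
  toFun T := ofOp (C ∘L toOp T ∘L D)
    (ne_top_of_le_ne_top ENNReal.ofReal_ne_top (traceAbs_conj_toOp_le C D T))
  map_add' S T := toOp_injective (by simp only [toOp_ofOp, map_add, add_comp, comp_add])
  map_smul' c T := toOp_injective (by
    simp only [toOp_ofOp, map_smul, smul_comp, comp_smul, RingHom.id_apply])

/-- `T ↦ C T D` as a map of trace class operators. -/
def conj (C : K →L[ℂ] L) (D : L →L[ℂ] K) : TraceClass K →L[ℂ] TraceClass L :=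
  (conjLin C D).mkContinuous (‖C‖ * ‖D‖) fun T =>
    norm_le_of_traceAbs_le (by positivity) (traceAbs_conj_toOp_le C D T)

theorem toOp_conj (C : K →L[ℂ] L) (D : L →L[ℂ] K) (T : TraceClass K) :
    toOp (conj C D T) = C ∘L toOp T ∘L D := rfl

theorem traceAbs_rankOne_le_ofReal (x y : K) :
    traceAbs (rankOne ℂ x y) ≤ ENNReal.ofReal (‖x‖ * ‖y‖) := by
  rw [ENNReal.ofReal_mul (norm_nonneg _), ofReal_norm, ofReal_norm]
  exact traceAbs_rankOne_le x y

/-- The operator `z ↦ ⟨y, z⟩ x` as a trace class operator. -/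
def dyad (x y : K) : TraceClass K := ofOp (rankOne ℂ x y)
  (ne_top_of_le_ne_top ENNReal.ofReal_ne_top (traceAbs_rankOne_le_ofReal x y))

theorem toOp_dyad (x y : K) : toOp (dyad x y) = rankOne ℂ x y := rfl

theorem norm_dyad_le (x y : K) : ‖dyad x y‖ ≤ ‖x‖ * ‖y‖ :=
  norm_le_of_traceAbs_le (by positivity) (traceAbs_rankOne_le_ofReal x y)

theorem summable_trace (T : TraceClass K) (X : K →L[ℂ] K) :
    Summable fun i => ⟪stdBasis K i, (toOp T * X) (stdBasis K i)⟫_ℂ := by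
  -- `T X` is trace class by the ideal property, and the diagonal of a trace class operator is
  -- absolutely summable.
  have h := tsum_inner_le_traceAbs (toOp (conj 1 X T)) 1 (fun x => le_rfl)
  refine Summable.of_norm ?_
  have h1 := ENNReal.summable_toReal (ne_top_of_le_ne_top (traceAbs_toOp_ne_top _) h)
  simpa [toOp_conj] using h1

/-- The trace pairing `(T, X) ↦ trace (T X)`. -/
def pairing : TraceClass K →ₗ[ℂ] (K →L[ℂ] K) →ₗ[ℂ] ℂ :=
  LinearMap.mk₂ ℂ (fun T X => opTrace (toOp T * X))
    (fun S T X => by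
      unfold opTrace
      rw [← (summable_trace S X).tsum_add (summable_trace T X)]
      simp [add_mul])
    (fun c T X => by
      unfold opTrace
      rw [smul_eq_mul, ← (summable_trace T X).tsum_mul_left]
      simp)
    (fun T X Y => by
      unfold opTrace
      rw [← (summable_trace T X).tsum_add (summable_trace T Y)]
      simp)
    (fun c T X => by
      unfold opTrace
      rw [smul_eq_mul, ← (summable_trace T X).tsum_mul_left]
      simp)

theorem pairing_apply (T : TraceClass K) (X : K →L[ℂ] K) :
    pairing T X = opTrace (toOp T * X) := rfl

theorem norm_pairing_le (T : TraceClass K) (X : K →L[ℂ] K) : ‖pairing T X‖ ≤ ‖X‖ * ‖T‖ := by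
  have h1 : ‖pairing T X‖ₑ ≤ ‖X‖ₑ * ‖T‖ₑ := by
    have h := tsum_inner_le_traceAbs (toOp (conj 1 X T)) 1 (fun x => le_rfl)
    calc _ ≤ ∑' i, ‖⟪stdBasis K i, (toOp T * X) (stdBasis K i)⟫_ℂ‖ₑ :=
          enorm_tsum_le_tsum_enorm
      _ ≤ _ := h
      _ ≤ _ := traceAbs_conj_le 1 (toOp T) X
      _ ≤ _ := by
        rw [enorm_eq]
        gcongr
        exact (mul_le_mul_left (enorm_le_one_of_contraction fun x => le_rfl) _).trans_eq
          (one_mul _)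
  rw [← ofReal_norm, ← ofReal_norm, ← ofReal_norm, ← ENNReal.ofReal_mul (norm_nonneg _)] at h1
  exact (ENNReal.ofReal_le_ofReal_iff (by positivity)).1 h1

theorem continuous_pairing (X : K →L[ℂ] K) : Continuous fun T : TraceClass K => pairing T X :=
  AddMonoidHomClass.continuous_of_bound (pairing.flip X) ‖X‖ fun T => norm_pairing_le T X

theorem tsum_inner_mul_inner_stdBasis (u v : K) :
    ∑' i, ⟪u, stdBasis K i⟫_ℂ * ⟪stdBasis K i, v⟫_ℂ = ⟪u, v⟫_ℂ :=
  (stdBasis K).tsum_inner_mul_inner u v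

theorem pairing_rankOne (T : TraceClass K) (x y : K) :
    pairing T (rankOne ℂ x y) = ⟪y, toOp T x⟫_ℂ := by
  rw [pairing_apply, opTrace, ← tsum_inner_mul_inner_stdBasis]
  simp

theorem pairing_dyad (X : K →L[ℂ] K) (x y : K) : pairing (dyad x y) X = ⟪y, X x⟫_ℂ := by
  rw [pairing_apply, opTrace, ← adjoint_inner_left, ← tsum_inner_mul_inner_stdBasis]
  simp [toOp_dyad, adjoint_inner_left]

end TraceClass

/-! ### Approximation by compressions to finitely many basis vectors -/

section Truncation

variable {K : Type*} [NormedAddCommGroup K] [InnerProductSpace ℂ K] [CompleteSpace K]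

/-- The orthogonal projection onto the span of finitely many vectors of the Hilbert basis. -/
def basisProj (A : Finset (stdIndex K)) : K →L[ℂ] K :=
  ∑ a ∈ A, rankOne ℂ (stdBasis K a) (stdBasis K a)

theorem basisProj_apply (A : Finset (stdIndex K)) (x : K) :
    basisProj A x = ∑ a ∈ A, ⟪stdBasis K a, x⟫_ℂ • stdBasis K a := by
  simp [basisProj]

theorem basisProj_stdBasis [DecidableEq (stdIndex K)] (A : Finset (stdIndex K))
    (i : stdIndex K) : basisProj A (stdBasis K i) = if i ∈ A then stdBasis K i else 0 := by
  rw [basisProj_apply]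
  simp [orthonormal_iff_ite.1 (stdBasis K).orthonormal]

theorem inner_basisProj_left (A : Finset (stdIndex K)) (x y : K) :
    ⟪basisProj A x, y⟫_ℂ = ⟪x, basisProj A y⟫_ℂ := by
  simp [basisProj, mul_comm]

theorem adjoint_basisProj (A : Finset (stdIndex K)) : adjoint (basisProj A) = basisProj A := by
  ext x
  refine ext_inner_left ℂ fun y => ?_
  rw [adjoint_inner_right, inner_basisProj_left]

theorem basisProj_basisProj (A : Finset (stdIndex K)) (x : K) :
    basisProj A (basisProj A x) = basisProj A x := by
  classical
  conv_lhs => rw [basisProj_apply A x, map_sum]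
  rw [basisProj_apply]
  refine Finset.sum_congr rfl fun a ha => ?_
  rw [map_smul, basisProj_stdBasis, if_pos ha]

theorem norm_basisProj_apply_le (A : Finset (stdIndex K)) (x : K) : ‖basisProj A x‖ ≤ ‖x‖ := by
  have h : ‖basisProj A x‖ * ‖basisProj A x‖ ≤ ‖x‖ * ‖basisProj A x‖ := by
    rw [← inner_self_eq_norm_mul_norm (𝕜 := ℂ), inner_basisProj_left, basisProj_basisProj]
    exact re_inner_le_norm _ _
  rcases (norm_nonneg (basisProj A x)).eq_or_lt with h0 | h0
  · rw [← h0]; exact norm_nonneg _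
  · exact le_of_mul_le_mul_right h h0

/-- Removing the basis vectors in `A` leaves the tail of the convergent series that defines `hsSq
S`. -/
theorem tendsto_hsSq_comp_sub_basisProj {L : Type*} [NormedAddCommGroup L]
    [InnerProductSpace ℂ L] (S : K →L[ℂ] L) (hS : hsSq S ≠ ⊤) :
    Tendsto (fun A => hsSq (S ∘L (1 - basisProj A))) atTop (𝓝 0) := by
  classical
  refine (ENNReal.tendsto_tsum_compl_atTop_zero hS).congr fun A => ?_
  unfold hsSq
  refine (tsum_subtype {x | x ∉ A} (fun i => ‖S (stdBasis K i)‖ₑ ^ 2)).trans ?_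
  congr 1; ext i
  by_cases hi : i ∈ A <;> simp [basisProj_stdBasis, hi]

end Truncation

namespace TraceClass

variable {K : Type*} [NormedAddCommGroup K] [InnerProductSpace ℂ K] [CompleteSpace K]

/-- The compression `T ↦ P T P` by the projection `P` onto the span of finitely many vectors of
the Hilbert basis. -/
def compress (A : Finset (stdIndex K)) : TraceClass K →L[ℂ] TraceClass K :=
  conj (basisProj A) (basisProj A)

theorem compress_apply (A : Finset (stdIndex K)) (T : TraceClass K) :
    compress A T = ∑ p ∈ A ×ˢ A, ⟪stdBasis K p.1, toOp T (stdBasis K p.2)⟫_ℂ •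
      dyad (stdBasis K p.1) (stdBasis K p.2) := by
  refine toOp_injective ?_
  ext x
  rw [compress, toOp_conj, Finset.sum_product, map_sum]
  simp only [comp_apply, sum_apply, map_sum, map_smul, smul_apply, toOp_dyad, rankOne_apply]
  rw [basisProj_apply A x, map_sum, map_sum, Finset.sum_comm]
  refine Finset.sum_congr rfl fun b _ => ?_
  rw [map_smul, map_smul, basisProj_apply, Finset.smul_sum]
  refine Finset.sum_congr rfl fun a _ => ?_
  rw [smul_comm]

theorem compress_dyad (A : Finset (stdIndex K)) (x y : K) :
    compress A (dyad x y) = dyad (basisProj A x) (basisProj A y) := by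
  refine toOp_injective ?_
  ext z
  simp [compress, toOp_conj, toOp_dyad, inner_basisProj_left]

/-- With `T = S R` and a projection `P`, one has `T - P T P = S (R (1 - P)) + ((1 - P) S) (R P)`. In
each product one Hilbert–Schmidt factor tends to zero and the other stays bounded. -/
theorem tendsto_compress (T : TraceClass K) : Tendsto (fun A => compress A T) atTop (𝓝 T) := by
  obtain ⟨S, R, hSR, hS, hR⟩ := exists_hsSq_factor (toOp T)
  have hS' : hsSq S ≠ ⊤ := ne_top_of_le_ne_top T.traceAbs_toOp_ne_top hS
  have hR' : hsSq R ≠ ⊤ := ne_top_of_le_ne_top T.traceAbs_toOp_ne_top hR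
  have hP : ∀ A : Finset (stdIndex K), ‖basisProj A‖ₑ ≤ 1 := fun A =>
    enorm_le_one_of_contraction (norm_basisProj_apply_le A)
  have key : ∀ A, ‖T - compress A T‖ₑ ≤
      hsSq S ^ (1 / 2 : ℝ) * hsSq (R ∘L (1 - basisProj A)) ^ (1 / 2 : ℝ) +
        hsSq (adjoint S ∘L (1 - basisProj A)) ^ (1 / 2 : ℝ) * hsSq R ^ (1 / 2 : ℝ) := by
    intro A
    have h1 : toOp (T - compress A T) = S ∘L (R ∘L (1 - basisProj A)) +
        ((1 - basisProj A) ∘L S) ∘L (R ∘L basisProj A) := by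
      rw [map_sub, compress, toOp_conj, ← hSR]
      ext x
      simp
    rw [enorm_eq, h1]
    refine (traceAbs_add_le _ _).trans (add_le_add (traceAbs_comp_le _ _) ?_)
    refine (traceAbs_comp_le _ _).trans ?_
    -- Passing to the adjoint moves `1 - P` to the right, where the tail estimate applies.
    have h2 : hsSq ((1 - basisProj A) ∘L S) = hsSq (adjoint S ∘L (1 - basisProj A)) := by
      rw [← hsSq_adjoint, adjoint_comp, map_sub, adjoint_basisProj]
      congr 3
      exact adjoint_id
    rw [h2]
    gcongr
    refine (hsSq_comp_le_right _ _).trans ?_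
    grw [hP]
    simp
  have hlim : Tendsto (fun A : Finset (stdIndex K) =>
      hsSq S ^ (1 / 2 : ℝ) * hsSq (R ∘L (1 - basisProj A)) ^ (1 / 2 : ℝ) +
        hsSq (adjoint S ∘L (1 - basisProj A)) ^ (1 / 2 : ℝ) * hsSq R ^ (1 / 2 : ℝ))
      atTop (𝓝 0) := by
    have hpow : ∀ {f : Finset (stdIndex K) → ℝ≥0∞}, Tendsto f atTop (𝓝 0) →
        Tendsto (fun A => f A ^ (1 / 2 : ℝ)) atTop (𝓝 0) := fun {f} hf => by
      simpa using hf.ennrpow_const (1 / 2)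
    have h1 := ENNReal.Tendsto.const_mul (a := hsSq S ^ (1 / 2 : ℝ))
      (hpow (tendsto_hsSq_comp_sub_basisProj R hR')) (Or.inr (by finiteness))
    have h2 := ENNReal.Tendsto.mul_const (b := hsSq R ^ (1 / 2 : ℝ))
      (hpow (tendsto_hsSq_comp_sub_basisProj (adjoint S) (by rwa [hsSq_adjoint])))
      (Or.inr (by finiteness))
    simpa using h1.add h2
  have h3 : Tendsto (fun A => ‖T - compress A T‖ₑ) atTop (𝓝 0) :=
    tendsto_of_tendsto_of_tendsto_of_le_of_le tendsto_const_nhds hlim (fun _ => zero_le) key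
  have h4 := (ENNReal.tendsto_toReal ENNReal.zero_ne_top).comp h3
  rw [tendsto_iff_norm_sub_tendsto_zero]
  simpa [Function.comp_def, norm_sub_rev] using h4

/-- A continuous functional on the trace class operators is bounded by its values on the operators
of rank one. -/
theorem norm_apply_le_of_dyad (f : TraceClass K →ₗ[ℂ] ℂ) (hf : Continuous f) {c : ℝ} (hc : 0 ≤ c)
    (h : ∀ x y : K, ‖f (dyad x y)‖ ≤ c * (‖x‖ * ‖y‖)) (T : TraceClass K) :
    ‖f T‖ ≤ c * ‖T‖ := by
  have key : ∀ A, ‖f (compress A T)‖ ≤ c * ‖T‖ := by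
    intro A
    -- On compressed operators the functional is the trace pairing with a finite rank `B`. The
    -- indices are swapped because pairing with `|e_b⟩⟨e_a|` extracts the entry `⟨e_a, T e_b⟩`. The
    -- matrix entries of `B` are values of `f` on dyads, so `‖B‖ ≤ c`.
    set B : K →L[ℂ] K := ∑ p ∈ A ×ˢ A, f (dyad (stdBasis K p.1) (stdBasis K p.2)) •
      rankOne ℂ (stdBasis K p.2) (stdBasis K p.1) with hB
    have hBT : ∀ S : TraceClass K, pairing S B = f (compress A S) := fun S => by
      rw [compress_apply, hB, map_sum, map_sum]
      refine Finset.sum_congr rfl fun p _ => ?_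
      rw [map_smul, map_smul, pairing_rankOne, smul_eq_mul, smul_eq_mul, mul_comm]
    have hBn : ‖B‖ ≤ c := by
      refine opNorm_le_of_re_inner_le hc fun x y hx hy => ?_
      refine (RCLike.re_le_norm _).trans ?_
      rw [norm_inner_symm, ← pairing_dyad, hBT, compress_dyad]
      refine (h _ _).trans ?_
      grw [norm_basisProj_apply_le, norm_basisProj_apply_le, hx, hy]
      simp
    rw [← hBT]
    refine (norm_pairing_le T B).trans ?_
    gcongr
  exact le_of_tendsto ((hf.tendsto _).comp (tendsto_compress T)).norm (Eventually.of_forall key)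

end TraceClass

/-! ### Multilinear forms on trace class operators -/

section Multilinear

variable {N : ℕ}

/-- Expansion of all arguments of a multilinear map but one. -/
theorem MultilinearMap.map_eq_sum_update {ι R F : Type*} {E κ : ι → Type*} [Fintype ι]
    [DecidableEq ι] [CommSemiring R] [∀ k, AddCommMonoid (E k)] [∀ k, Module R (E k)]
    [AddCommMonoid F] [Module R F] (M : MultilinearMap R E F) {k₀ : ι} {i₀ : κ k₀}
    (A : ∀ k, Finset (κ k)) (hA₀ : A k₀ = {i₀}) (c : ∀ k, κ k → R) (b : ∀ k, κ k → E k)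
    (x : ∀ k, E k) (hx : ∀ k, k ≠ k₀ → ∑ a ∈ A k, c k a • b k a = x k) :
    M x = ∑ r ∈ Fintype.piFinset A, (∏ k ∈ Finset.univ.erase k₀, c k (r k)) •
      M (Function.update (fun k => b k (r k)) k₀ (x k₀)) := by
  -- Summing `x k₀` over the singleton `{i₀}` makes every argument a finite sum without expanding
  -- the one at `k₀`.
  have h1 : x = fun k => ∑ a ∈ A k, if k = k₀ then x k else c k a • b k a := by
    ext k
    by_cases hk : k = k₀
    · subst hk; simp [hA₀]
    · simp [hk, hx k hk]
  conv_lhs => rw [h1, M.map_sum_finset]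
  refine Finset.sum_congr rfl fun r _ => ?_
  have h2 : (fun k => if k = k₀ then x k else c k (r k) • b k (r k)) =
      fun k => (if k = k₀ then 1 else c k (r k)) •
        Function.update (fun k => b k (r k)) k₀ (x k₀) k := by
    ext k
    by_cases hk : k = k₀
    · subst hk; simp
    · simp [hk]
  rw [h2, M.map_smul_univ]
  congr 1
  rw [← Finset.mul_prod_erase _ _ (Finset.mem_univ k₀), if_pos rfl, one_mul]
  exact Finset.prod_congr rfl fun k hk => if_neg (Finset.ne_of_mem_erase hk)

theorem Fintype.sum_piFinset_product {ι F : Type*} {κ : ι → Type*} [Fintype ι] [DecidableEq ι]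
    [AddCommMonoid F] (A B : ∀ k, Finset (κ k)) (f : (∀ k, κ k) → (∀ k, κ k) → F) :
    ∑ r ∈ Fintype.piFinset (fun k => A k ×ˢ B k), f (fun k => (r k).1) (fun k => (r k).2) =
      ∑ α ∈ Fintype.piFinset A, ∑ β ∈ Fintype.piFinset B, f α β := by
  rw [← Finset.sum_product']
  refine Finset.sum_nbij' (fun r => (fun k => (r k).1, fun k => (r k).2))
    (fun p k => (p.1 k, p.2 k)) ?_ ?_ ?_ ?_ ?_
  · intro r hr
    simp only [Fintype.mem_piFinset, Finset.mem_product] at hr ⊢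
    exact ⟨fun k => (hr k).1, fun k => (hr k).2⟩
  · intro p hp
    simp only [Fintype.mem_piFinset, Finset.mem_product] at hp ⊢
    exact fun k => ⟨hp.1 k, hp.2 k⟩
  all_goals intros; rfl

variable {H : Fin N → Type*} [∀ k, NormedAddCommGroup (H k)]
    [∀ k, InnerProductSpace ℂ (H k)] [∀ k, CompleteSpace (H k)]

/-- A separately continuous multilinear form on trace class operators is bounded by its values on
operators of rank one. -/
theorem TraceClass.norm_multilinear_le_of_dyad
    (M : MultilinearMap ℂ (fun k => TraceClass (H k)) ℂ)
    (hM : ∀ T k, Continuous fun S => M (Function.update T k S))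
    (h : ∀ x y : ∀ k, H k, ‖M fun k => dyad (x k) (y k)‖ ≤ ∏ k, ‖x k‖ * ‖y k‖)
    (T : ∀ k, TraceClass (H k)) : ‖M T‖ ≤ ∏ k, ‖T k‖ := by
  classical
  -- Induction on the set `s` of variables already freed from rank one. Adjoining `j` freezes the
  -- others and applies the one-variable bound, with the product of the frozen norms as constant.
  have key : ∀ s : Finset (Fin N), ∀ T : ∀ k, TraceClass (H k), ∀ x y : ∀ k, H k,
      ‖M fun k => if k ∈ s then T k else dyad (x k) (y k)‖ ≤
        ∏ k, if k ∈ s then ‖T k‖ else ‖x k‖ * ‖y k‖ := by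
    intro s
    induction s using Finset.induction_on with
    | empty => intro T x y; simpa using h x y
    | insert j s hj ih =>
      intro T x y
      set U : ∀ k, TraceClass (H k) := fun k => if k ∈ s then T k else dyad (x k) (y k) with hU
      set c : ℝ := ∏ k ∈ Finset.univ.erase j, if k ∈ s then ‖T k‖ else ‖x k‖ * ‖y k‖ with hc
      have h1 := norm_apply_le_of_dyad (M.toLinearMap U j) (hM U j) (c := c)
        (Finset.prod_nonneg fun k _ => by split_ifs <;> positivity) (fun u v => by
          have h2 := ih T (Function.update x j u) (Function.update y j v)
          rw [← Finset.mul_prod_erase _ _ (Finset.mem_univ j), if_neg hj, mul_comm] at h2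
          convert h2 using 2
          · rw [MultilinearMap.toLinearMap_apply]
            congr 1
            ext k
            by_cases hk : k = j
            · subst hk; simp [hj]
            · simp [hk, hU]
          · refine Finset.prod_congr rfl fun k hk => ?_
            simp [Finset.ne_of_mem_erase hk]
          · simp) (T j)
      rw [MultilinearMap.toLinearMap_apply] at h1
      rw [← Finset.mul_prod_erase _ _ (Finset.mem_univ j), if_pos (Finset.mem_insert_self j s),
        mul_comm]
      convert h1 using 2
      · congr 1
        ext k
        by_cases hk : k = j
        · subst hk; simp
        · simp [hk, hU]
      · refine Finset.prod_congr rfl fun k hk => ?_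
        simp [Finset.ne_of_mem_erase hk]
  -- No dyads remain when all variables are free, so the zero vectors are mere fillers.
  simpa using key Finset.univ T (fun _ => 0) (fun _ => 0)

end Multilinear

/-! ### Block matrices along the factor `k₀` -/

section Slices

variable {N : ℕ} {H : Fin N → Type*} [∀ k, NormedAddCommGroup (H k)]
    [∀ k, InnerProductSpace ℂ (H k)]

variable (H) in
/-- The product vector as a multilinear map of its factors. -/
def tensorVecM : MultilinearMap ℂ H (HilbertTensor H) :=
  UniformSpace.Completion.toComplL.toLinearMap.compMultilinearMap (AlgTensor.mk H)

theorem tensorVecM_apply (x : ∀ k, H k) : tensorVecM H x = tensorVec x := rfl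

theorem norm_tensorVec (x : ∀ k, H k) : ‖tensorVec x‖ = ∏ k, ‖x k‖ := by
  have h : ((‖tensorVec x‖ ^ 2 : ℝ) : ℂ) = ((∏ k, ‖x k‖) ^ 2 : ℝ) := by
    have := inner_tensorVec x x
    simp only [inner_self_eq_norm_sq_to_K] at this
    push_cast
    rw [← Finset.prod_pow]
    exact_mod_cast this
  exact (sq_eq_sq₀ (norm_nonneg _) (Finset.prod_nonneg fun _ _ => norm_nonneg _)).1
    (by exact_mod_cast h)

theorem tensorOp_rankOne (x y : ∀ k, H k) :
    tensorOp (fun k => rankOne ℂ (x k) (y k)) = rankOne ℂ (tensorVec x) (tensorVec y) := by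
  refine ext_tensorVec fun z => ?_
  rw [tensorOp_apply, rankOne_apply, inner_tensorVec]
  simp only [rankOne_apply]
  exact (tensorVecM H).map_smul_univ _ _

variable [∀ k, CompleteSpace (H k)]

/-- The product of vectors of the Hilbert bases, with the factor at `k₀` left open. -/
def slice (k₀ : Fin N) (α : ∀ k, stdIndex (H k)) : H k₀ →L[ℂ] HilbertTensor H :=
  ((tensorVecM H).toLinearMap (fun k => stdBasis (H k) (α k)) k₀).mkContinuous 1 fun x => by
    rw [MultilinearMap.toLinearMap_apply, tensorVecM_apply, norm_tensorVec,
      ← Finset.mul_prod_erase _ _ (Finset.mem_univ k₀), Finset.prod_eq_one]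
    · simp
    · intro k hk
      simp [Finset.ne_of_mem_erase hk, (stdBasis (H k)).orthonormal.1 (α k)]

theorem slice_apply (k₀ : Fin N) (α : ∀ k, stdIndex (H k)) (x : H k₀) :
    slice k₀ α x = tensorVec (Function.update (fun k => stdBasis (H k) (α k)) k₀ x) := rfl

theorem adjoint_slice_tensorVec (k₀ : Fin N) (α : ∀ k, stdIndex (H k)) (x : ∀ k, H k) :
    adjoint (slice k₀ α) (tensorVec x) =
      (∏ k ∈ Finset.univ.erase k₀, ⟪stdBasis (H k) (α k), x k⟫_ℂ) • x k₀ := by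
  refine ext_inner_left ℂ fun y => ?_
  rw [adjoint_inner_right, slice_apply, inner_tensorVec,
    ← Finset.mul_prod_erase _ _ (Finset.mem_univ k₀), inner_smul_right, mul_comm]
  congr 1
  · refine Finset.prod_congr rfl fun k hk => ?_
    simp [Finset.ne_of_mem_erase hk]
  · simp

/-- The matrix entries of the factors of `T₁ ⊗ ⋯ ⊗ T_N` other than the one at `k₀`. -/
def entry (k₀ : Fin N) (α β : ∀ k, stdIndex (H k)) (T : ∀ k, TraceClass (H k)) : ℂ :=
  ∏ k ∈ Finset.univ.erase k₀, ⟪stdBasis (H k) (α k), (T k).toOp (stdBasis (H k) (β k))⟫_ℂ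

/-- Every block of an elementary tensor is a scalar multiple of its factor at `k₀`. This is what
lets a tensor be recovered from its operator. -/
theorem adjoint_slice_tensorOp_slice (k₀ : Fin N) (α β : ∀ k, stdIndex (H k))
    (T : ∀ k, TraceClass (H k)) :
    adjoint (slice k₀ α) ∘L tensorOp (fun k => (T k).toOp) ∘L slice k₀ β =
      entry k₀ α β T • (T k₀).toOp := by
  ext x
  rw [comp_apply, comp_apply, slice_apply, tensorOp_apply, adjoint_slice_tensorVec, smul_apply]
  simp only [Function.update_self]
  congr 1
  refine Finset.prod_congr rfl fun k hk => ?_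
  simp [Finset.ne_of_mem_erase hk]

theorem tensorOp_update_dyad (k₀ : Fin N) (α β : ∀ k, stdIndex (H k)) (B : TraceClass (H k₀)) :
    tensorOp (fun k => (Function.update
      (fun k => TraceClass.dyad (stdBasis (H k) (α k)) (stdBasis (H k) (β k))) k₀ B k).toOp) =
      slice k₀ α ∘L B.toOp ∘L adjoint (slice k₀ β) := by
  refine ext_tensorVec fun x => ?_
  rw [tensorOp_apply, comp_apply, comp_apply, adjoint_slice_tensorVec, map_smul, map_smul,
    slice_apply]
  have h : (fun k => (Function.update (fun k => TraceClass.dyad (stdBasis (H k) (α k))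
      (stdBasis (H k) (β k))) k₀ B k).toOp (x k)) = fun k =>
      (if k = k₀ then 1 else ⟪stdBasis (H k) (β k), x k⟫_ℂ) •
        Function.update (fun k => stdBasis (H k) (α k)) k₀ (B.toOp (x k₀)) k := by
    ext k
    by_cases hk : k = k₀
    · subst hk; simp
    · simp [hk, TraceClass.toOp_dyad]
  rw [h, ← tensorVecM_apply, MultilinearMap.map_smul_univ, tensorVecM_apply]
  congr 1
  rw [← Finset.mul_prod_erase _ _ (Finset.mem_univ k₀), if_pos rfl, one_mul]
  exact Finset.prod_congr rfl fun k hk => if_neg (Finset.ne_of_mem_erase hk)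

section Expansion

variable {k₀ : Fin N} {i₀ : stdIndex (H k₀)} {A : ∀ k, Finset (stdIndex (H k))}

/-- A resolution of the identity: the product vector is expanded in the bases of all factors but
`k₀`. The coordinate of `α` at `k₀` has no effect on `slice k₀ α`, and fixing it to `i₀` counts each
slice once. -/
theorem sum_slice_comp_adjoint (hA₀ : A k₀ = {i₀})
    (hA : ∀ k, k ≠ k₀ → basisProj (A k) = 1) :
    ∑ α ∈ Fintype.piFinset A, slice k₀ α ∘L adjoint (slice k₀ α) = 1 := by
  refine ext_tensorVec fun x => ?_
  rw [sum_apply, one_apply_eq_self]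
  refine Eq.trans (Finset.sum_congr rfl fun α _ => ?_) (MultilinearMap.map_eq_sum_update
    (tensorVecM H) A hA₀ (fun k a => ⟪stdBasis (H k) a, x k⟫_ℂ) (fun k a => stdBasis (H k) a) x
    (fun k hk => by rw [← basisProj_apply, hA k hk]; rfl)).symm
  rw [comp_apply, adjoint_slice_tensorVec, map_smul, slice_apply, tensorVecM_apply]

theorem eq_sum_slice (hA₀ : A k₀ = {i₀}) (hA : ∀ k, k ≠ k₀ → basisProj (A k) = 1)
    (X : HilbertTensor H →L[ℂ] HilbertTensor H) :
    X = ∑ α ∈ Fintype.piFinset A, ∑ β ∈ Fintype.piFinset A,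
      slice k₀ α ∘L (adjoint (slice k₀ α) ∘L X ∘L slice k₀ β) ∘L adjoint (slice k₀ β) := by
  have h := sum_slice_comp_adjoint hA₀ hA
  calc X = (1 : HilbertTensor H →L[ℂ] HilbertTensor H) ∘L X ∘L
        (1 : HilbertTensor H →L[ℂ] HilbertTensor H) := rfl
    _ = _ := by
      rw [← h, finsetSum_comp]
      refine Finset.sum_congr rfl fun α _ => ?_
      rw [comp_finsetSum, comp_finsetSum]
      rfl

/-- Each `T k` with `k ≠ k₀` equals its compression by the full projection, hence a finite
combination of matrix units; multilinearity does the rest, inside the algebraic tensor product. -/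
theorem tprod_eq_sum (hA₀ : A k₀ = {i₀}) (hA : ∀ k, k ≠ k₀ → basisProj (A k) = 1)
    (T : ∀ k, TraceClass (H k)) :
    PiTensorProduct.tprod ℂ T = ∑ α ∈ Fintype.piFinset A, ∑ β ∈ Fintype.piFinset A,
      entry k₀ α β T • PiTensorProduct.tprod ℂ (Function.update
      (fun k => TraceClass.dyad (stdBasis (H k) (α k)) (stdBasis (H k) (β k))) k₀ (T k₀)) := by
  rw [← Fintype.sum_piFinset_product A A (fun α β => entry k₀ α β T • PiTensorProduct.tprod ℂ
    (Function.update (fun k => TraceClass.dyad (stdBasis (H k) (α k)) (stdBasis (H k) (β k)))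
      k₀ (T k₀)))]
  refine MultilinearMap.map_eq_sum_update (κ := fun k => stdIndex (H k) × stdIndex (H k))
    (PiTensorProduct.tprod ℂ) (i₀ := (i₀, i₀))
    (fun k => A k ×ˢ A k) (by simp [hA₀])
    (fun k p => ⟪stdBasis (H k) p.1, (T k).toOp (stdBasis (H k) p.2)⟫_ℂ)
    (fun k p => TraceClass.dyad (stdBasis (H k) p.1) (stdBasis (H k) p.2)) T fun k hk => ?_
  rw [← TraceClass.compress_apply]
  refine TraceClass.toOp_injective ?_
  rw [TraceClass.compress, TraceClass.toOp_conj, hA k hk]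
  rfl

end Expansion

end Slices

/-! ### The canonical map as a bijection onto the trace class operators -/

section TensorTraceClass

variable {N : ℕ} {H : Fin N → Type*} [∀ k, NormedAddCommGroup (H k)]
    [∀ k, InnerProductSpace ℂ (H k)] [∀ k, CompleteSpace (H k)]

theorem tensorToOp_tprod (T : ∀ k, TraceClass (H k)) :
    tensorToOp (PiTensorProduct.tprod ℂ T) = tensorOp fun k => (T k).toOp :=
  PiTensorProduct.lift.tprod T

section Expansion

variable {k₀ : Fin N} {i₀ : stdIndex (H k₀)} {A : ∀ k, Finset (stdIndex (H k))}

theorem tensorOp_eq_toOp_sum (hA₀ : A k₀ = {i₀}) (hA : ∀ k, k ≠ k₀ → basisProj (A k) = 1)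
    (T : ∀ k, TraceClass (H k)) :
    tensorOp (fun k => (T k).toOp) = TraceClass.toOp (∑ α ∈ Fintype.piFinset A,
      ∑ β ∈ Fintype.piFinset A, entry k₀ α β T •
        TraceClass.conj (slice k₀ α) (adjoint (slice k₀ β)) (T k₀)) := by
  rw [eq_sum_slice hA₀ hA (tensorOp fun k => (T k).toOp), map_sum]
  refine Finset.sum_congr rfl fun α _ => ?_
  rw [map_sum]
  refine Finset.sum_congr rfl fun β _ => ?_
  rw [adjoint_slice_tensorOp_slice, map_smul, TraceClass.toOp_conj, smul_comp, comp_smul]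

theorem exists_tensorToTraceClass (hA₀ : A k₀ = {i₀})
    (hA : ∀ k, k ≠ k₀ → basisProj (A k) = 1) :
    ∃ Φ : (⨂[ℂ] k, TraceClass (H k)) →ₗ[ℂ] TraceClass (HilbertTensor H),
      ∀ z, (Φ z).toOp = tensorToOp z := by
  refine ⟨LinearMap.codRestrict (traceClassSubmodule (HilbertTensor H)) tensorToOp fun z => ?_,
    fun z => rfl⟩
  induction z using PiTensorProduct.induction_on with
  | smul_tprod r T =>
    rw [map_smul, tensorToOp_tprod, tensorOp_eq_toOp_sum hA₀ hA]
    exact Submodule.smul_mem _ _ (TraceClass.traceAbs_toOp_ne_top _)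
  | add x y hx hy =>
    rw [map_add]
    exact Submodule.add_mem _ hx hy

variable {Φ : (⨂[ℂ] k, TraceClass (H k)) →ₗ[ℂ] TraceClass (HilbertTensor H)}

/-- `B ↦ ⨂ₖ |e_{αₖ}⟩⟨e_{βₖ}|` with the factor at `k₀` replaced by `B`. -/
def blockTensor (k₀ : Fin N) (α β : ∀ k, stdIndex (H k)) :
    TraceClass (H k₀) →ₗ[ℂ] ⨂[ℂ] k, TraceClass (H k) :=
  (PiTensorProduct.tprod ℂ).toLinearMap
    (fun k => TraceClass.dyad (stdBasis (H k) (α k)) (stdBasis (H k) (β k))) k₀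

/-- An explicit left inverse of `Φ`: cut `Φ z` into its blocks and put each block back into the
tensor product. -/
theorem eq_sum_blockTensor (hΦ : ∀ z, (Φ z).toOp = tensorToOp z) (hA₀ : A k₀ = {i₀})
    (hA : ∀ k, k ≠ k₀ → basisProj (A k) = 1) (z : ⨂[ℂ] k, TraceClass (H k)) :
    z = ∑ α ∈ Fintype.piFinset A, ∑ β ∈ Fintype.piFinset A, blockTensor k₀ α β
      (TraceClass.conj (adjoint (slice k₀ α)) (slice k₀ β) (Φ z)) := by
  induction z using PiTensorProduct.induction_on with
  | smul_tprod r T =>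
    simp only [map_smul, ← Finset.smul_sum]
    congr 1
    refine (tprod_eq_sum hA₀ hA T).trans ?_
    refine Finset.sum_congr rfl fun α _ => Finset.sum_congr rfl fun β _ => ?_
    have h : TraceClass.conj (adjoint (slice k₀ α)) (slice k₀ β) (Φ (PiTensorProduct.tprod ℂ T)) =
        entry k₀ α β T • T k₀ := TraceClass.toOp_injective (by
      rw [TraceClass.toOp_conj, hΦ, tensorToOp_tprod, adjoint_slice_tensorOp_slice, map_smul])
    rw [h, map_smul]
    rfl
  | add x y hx hy =>
    simp only [map_add, Finset.sum_add_distrib]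
    rw [← hx, ← hy]

theorem toOp_blockTensor (hΦ : ∀ z, (Φ z).toOp = tensorToOp z) (α β : ∀ k, stdIndex (H k))
    (B : TraceClass (H k₀)) :
    (Φ (blockTensor k₀ α β B)).toOp = slice k₀ α ∘L B.toOp ∘L adjoint (slice k₀ β) := by
  rw [hΦ, ← tensorOp_update_dyad, ← tensorToOp_tprod]
  rfl

theorem bijective_tensorToTraceClass (hΦ : ∀ z, (Φ z).toOp = tensorToOp z) (hA₀ : A k₀ = {i₀})
    (hA : ∀ k, k ≠ k₀ → basisProj (A k) = 1) : Function.Bijective Φ := by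
  constructor
  · intro z w h
    rw [eq_sum_blockTensor hΦ hA₀ hA z, eq_sum_blockTensor hΦ hA₀ hA w, h]
  · intro T
    refine ⟨∑ α ∈ Fintype.piFinset A, ∑ β ∈ Fintype.piFinset A, blockTensor k₀ α β
      (TraceClass.conj (adjoint (slice k₀ α)) (slice k₀ β) T), TraceClass.toOp_injective ?_⟩
    -- The same reassembly of blocks is a right inverse, because an operator is the sum of its
    -- blocks.
    rw [eq_sum_slice hA₀ hA T.toOp]
    simp only [map_sum, toOp_blockTensor hΦ, TraceClass.toOp_conj]

theorem tensorToTraceClass_tprod (hΦ : ∀ z, (Φ z).toOp = tensorToOp z)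
    (hA₀ : A k₀ = {i₀}) (hA : ∀ k, k ≠ k₀ → basisProj (A k) = 1)
    (T : ∀ k, TraceClass (H k)) :
    Φ (PiTensorProduct.tprod ℂ T) = ∑ α ∈ Fintype.piFinset A, ∑ β ∈ Fintype.piFinset A,
      entry k₀ α β T • TraceClass.conj (slice k₀ α) (adjoint (slice k₀ β)) (T k₀) :=
  TraceClass.toOp_injective (by rw [hΦ, tensorToOp_tprod, tensorOp_eq_toOp_sum hA₀ hA])

theorem entry_update (α β : ∀ k, stdIndex (H k))
    (T : ∀ k, TraceClass (H k)) (S : TraceClass (H k₀)) :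
    entry k₀ α β (Function.update T k₀ S) = entry k₀ α β T := by
  refine Finset.prod_congr rfl fun k hk => ?_
  rw [Function.update_of_ne (Finset.ne_of_mem_erase hk)]

/-- The coefficients `entry` omit the factor at `k₀`, so the map is a finite sum of fixed multiples
of the continuous maps `TraceClass.conj`. -/
theorem continuous_tprod_update (hΦ : ∀ z, (Φ z).toOp = tensorToOp z)
    (hA₀ : A k₀ = {i₀}) (hA : ∀ k, k ≠ k₀ → basisProj (A k) = 1) (T : ∀ k, TraceClass (H k)) :
    Continuous fun S => Φ (PiTensorProduct.tprod ℂ (Function.update T k₀ S)) := by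
  refine (∑ α ∈ Fintype.piFinset A, ∑ β ∈ Fintype.piFinset A, entry k₀ α β T •
    TraceClass.conj (slice k₀ α) (adjoint (slice k₀ β))).continuous.congr fun S => ?_
  rw [tensorToTraceClass_tprod hΦ hA₀ hA, sum_apply]
  refine Finset.sum_congr rfl fun α _ => ?_
  rw [sum_apply]
  refine Finset.sum_congr rfl fun β _ => ?_
  rw [entry_update, Function.update_self, smul_apply]

end Expansion

/-! ### Upper bound: pairing with operators of `V`-norm at most one -/

theorem finiteDimensional_traceClass {K : Type*} [NormedAddCommGroup K] [InnerProductSpace ℂ K]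
    [CompleteSpace K] [FiniteDimensional ℂ K] : FiniteDimensional ℂ (TraceClass K) :=
  FiniteDimensional.of_injective ((coeLM ℂ).comp (TraceClass.toOp (K := K)))
    (ContinuousLinearMap.coe_injective.comp TraceClass.toOp_injective)

omit [∀ k, CompleteSpace (H k)] in
theorem norm_inner_tensorVec_le {X : HilbertTensor H →L[ℂ] HilbertTensor H}
    (hX : opNormOn (productVectors H) X ≤ 1) (x y : ∀ k, H k) :
    ‖⟪tensorVec y, X (tensorVec x)⟫_ℂ‖ ≤ ∏ k, ‖x k‖ * ‖y k‖ := by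
  have hnn : 0 ≤ ∏ k, ‖x k‖ * ‖y k‖ := Finset.prod_nonneg fun k _ => by positivity
  -- Normalising the factors needs them nonzero; a zero factor makes the product vector, and so the
  -- left side, vanish.
  have hz : ∀ u : ∀ k, H k, (∃ k, u k = 0) → tensorVec u = 0 := fun u ⟨k, hk⟩ =>
    (tensorVecM H).map_coord_zero k hk
  by_cases hx : ∃ k, x k = 0
  · simpa [hz x hx] using hnn
  by_cases hy : ∃ k, y k = 0
  · simpa [hz y hy] using hnn
  push Not at hx hy
  have hn : ∀ u : ∀ k, H k, (∀ k, u k ≠ 0) → ∃ v ∈ productVectors H,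
      tensorVec u = ((∏ k, ‖u k‖ : ℝ) : ℂ) • v := fun u hu => by
    refine ⟨tensorVec fun k => ((‖u k‖⁻¹ : ℝ) : ℂ) • u k, ⟨_, fun k => ?_, rfl⟩, ?_⟩
    · simp [norm_smul, hu k]
    · rw [Complex.ofReal_prod, ← tensorVecM_apply, ← tensorVecM_apply,
        ← MultilinearMap.map_smul_univ]
      congr 1; ext k
      rw [smul_smul, ← Complex.ofReal_mul, mul_inv_cancel₀ (norm_ne_zero_iff.2 (hu k))]
      simp
  obtain ⟨v, hv, hxv⟩ := hn x hx
  obtain ⟨w, hw, hyw⟩ := hn y hy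
  have h1 : ‖⟪w, X v⟫_ℂ‖ₑ ≤ 1 :=
    ((le_iSup₂ (f := fun η (_ : η ∈ productVectors H) => ‖⟪η, X v⟫_ℂ‖ₑ) w hw).trans
      (le_iSup₂ (f := fun ξ (_ : ξ ∈ productVectors H) => ⨆ η ∈ productVectors H,
        ‖⟪η, X ξ⟫_ℂ‖ₑ) v hv)).trans hX
  have h2 : ‖⟪w, X v⟫_ℂ‖ ≤ 1 := by
    rwa [← ofReal_norm, ENNReal.ofReal_le_one] at h1
  rw [hxv, hyw, map_smul, inner_smul_left, inner_smul_right, norm_mul, norm_mul, RCLike.norm_conj,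
    Complex.norm_real, Complex.norm_real, Real.norm_of_nonneg (by positivity),
    Real.norm_of_nonneg (by positivity), Finset.prod_mul_distrib]
  calc _ ≤ (∏ k, ‖y k‖) * ((∏ k, ‖x k‖) * 1) := by gcongr
    _ = _ := by ring

variable {Φ : (⨂[ℂ] k, TraceClass (H k)) →ₗ[ℂ] TraceClass (HilbertTensor H)}

theorem tensorToTraceClass_dyad (hΦ : ∀ z, (Φ z).toOp = tensorToOp z) (x y : ∀ k, H k) :
    Φ (PiTensorProduct.tprod ℂ fun k => TraceClass.dyad (x k) (y k)) =
      TraceClass.dyad (tensorVec x) (tensorVec y) := by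
  refine TraceClass.toOp_injective ?_
  rw [hΦ, tensorToOp_tprod, TraceClass.toOp_dyad, ← tensorOp_rankOne]
  rfl

theorem norm_pairing_tensor_le (hΦ : ∀ z, (Φ z).toOp = tensorToOp z)
    {X : HilbertTensor H →L[ℂ] HilbertTensor H}
    (hcont : ∀ T k, Continuous fun S => TraceClass.pairing
      (Φ (PiTensorProduct.tprod ℂ (Function.update T k S))) X)
    (hX : opNormOn (productVectors H) X ≤ 1) (z : ⨂[ℂ] k, TraceClass (H k)) :
    ‖TraceClass.pairing (Φ z) X‖ ≤ ‖z‖ := by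
  set F : (⨂[ℂ] k, TraceClass (H k)) →ₗ[ℂ] ℂ := (TraceClass.pairing.flip X).comp Φ with hF
  set M := F.compMultilinearMap (PiTensorProduct.tprod ℂ) with hM
  have h1 : ∀ T, ‖M T‖ ≤ 1 * ∏ k, ‖T k‖ := fun T => by
    rw [one_mul]
    refine TraceClass.norm_multilinear_le_of_dyad M hcont (fun x y => ?_) T
    change ‖TraceClass.pairing (Φ (PiTensorProduct.tprod ℂ fun k => _)) X‖ ≤ _
    rw [tensorToTraceClass_dyad hΦ, TraceClass.pairing_dyad]
    exact norm_inner_tensorVec_le hX x y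
  -- The projective norm dominates every functional that comes from a multilinear form of norm at
  -- most `1`.
  have h2 := PiTensorProduct.norm_eval_le_projectiveSeminorm (M.mkContinuous 1 h1) z
  have h3 : PiTensorProduct.lift (M.mkContinuous 1 h1).toMultilinearMap = F := by
    refine PiTensorProduct.ext ?_
    ext T
    simp [hM]
  rw [h3] at h2
  refine h2.trans ?_
  grw [M.mkContinuous_norm_le zero_le_one h1]
  simp

/-! ### Lower bound: finite rank operators from functionals -/

/-- The finite rank operator that represents the compression of a functional on the tensor product
of the trace class spaces. -/
def dualOp (g : (⨂[ℂ] k, TraceClass (H k)) →ₗ[ℂ] ℂ) (A : ∀ k, Finset (stdIndex (H k))) :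
    HilbertTensor H →L[ℂ] HilbertTensor H :=
  ∑ r ∈ Fintype.piFinset fun k => A k ×ˢ A k,
    g (PiTensorProduct.tprod ℂ fun k =>
      TraceClass.dyad (stdBasis (H k) (r k).1) (stdBasis (H k) (r k).2)) •
    rankOne ℂ (tensorVec fun k => stdBasis (H k) (r k).2)
      (tensorVec fun k => stdBasis (H k) (r k).1)

theorem isCompactOperator_dualOp (g : (⨂[ℂ] k, TraceClass (H k)) →ₗ[ℂ] ℂ)
    (A : ∀ k, Finset (stdIndex (H k))) : IsCompactOperator (dualOp g A) := by
  refine Submodule.sum_mem (compactOperator (RingHom.id ℂ) (HilbertTensor H) (HilbertTensor H))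
    fun r _ => Submodule.smul_mem _ _ ?_
  change IsCompactOperator (toSpanSingleton ℂ _ ∘ innerSL ℂ _)
  exact (isCompactOperator_of_locallyCompactSpace_dom (innerSL ℂ _)).clm_comp _

theorem pairing_dualOp (hΦ : ∀ z, (Φ z).toOp = tensorToOp z)
    (g : (⨂[ℂ] k, TraceClass (H k)) →ₗ[ℂ] ℂ) (A : ∀ k, Finset (stdIndex (H k)))
    (z : ⨂[ℂ] k, TraceClass (H k)) :
    TraceClass.pairing (Φ z) (dualOp g A) =
      g (PiTensorProduct.mapL (fun k => TraceClass.compress (A k)) z) := by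
  have h : (TraceClass.pairing.flip (dualOp g A)).comp Φ = g.comp
      (PiTensorProduct.mapL fun k => TraceClass.compress (A k)).toLinearMap := by
    refine PiTensorProduct.ext ?_
    ext T
    change TraceClass.pairing (Φ (PiTensorProduct.tprod ℂ T)) (dualOp g A) =
      g (PiTensorProduct.mapL _ (PiTensorProduct.tprod ℂ T))
    rw [PiTensorProduct.mapL_apply, PiTensorProduct.map_tprod]
    simp only [coe_coe, TraceClass.compress_apply]
    rw [MultilinearMap.map_sum_finset, map_sum, dualOp, map_sum]
    refine Finset.sum_congr rfl fun r _ => ?_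
    rw [MultilinearMap.map_smul_univ, map_smul, map_smul, TraceClass.pairing_rankOne, hΦ,
      tensorToOp_tprod, tensorOp_apply, inner_tensorVec, smul_eq_mul, smul_eq_mul, mul_comm]
  exact LinearMap.congr_fun h z

/-- Between product vectors the matrix entry of `dualOp g A` is `g` at an elementary tensor of dyads
of projected vectors, whose projective norm is at most the product of their norms. -/
theorem opNormOn_dualOp_le (hΦ : ∀ z, (Φ z).toOp = tensorToOp z)
    {g : StrongDual ℂ (⨂[ℂ] k, TraceClass (H k))} (hg : ‖g‖ ≤ 1)
    (A : ∀ k, Finset (stdIndex (H k))) :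
    opNormOn (productVectors H) (dualOp g.toLinearMap A) ≤ 1 := by
  refine iSup₂_le fun v hv => iSup₂_le fun w hw => ?_
  obtain ⟨x, hx, rfl⟩ := hv
  obtain ⟨y, hy, rfl⟩ := hw
  rw [← TraceClass.pairing_dyad, ← tensorToTraceClass_dyad hΦ, pairing_dualOp hΦ,
    PiTensorProduct.mapL_apply, PiTensorProduct.map_tprod]
  simp only [coe_coe, TraceClass.compress_dyad]
  rw [← ofReal_norm, ← ENNReal.ofReal_one]
  refine ENNReal.ofReal_le_ofReal ?_
  refine (g.le_of_opNorm_le hg _).trans ?_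
  rw [one_mul]
  refine (PiTensorProduct.projectiveSeminorm_tprod_le _).trans ?_
  refine Finset.prod_le_one (fun k _ => norm_nonneg _) fun k _ => ?_
  refine (TraceClass.norm_dyad_le _ _).trans ?_
  grw [norm_basisProj_apply_le, norm_basisProj_apply_le, hx, hy]
  simp

/-- By linearity elementary tensors suffice, and there it follows from convergence in each factor
and joint continuity of `tprodL`. -/
theorem tendsto_mapL_compress (z : ⨂[ℂ] k, TraceClass (H k)) :
    Tendsto (fun A : ∀ k, Finset (stdIndex (H k)) =>
      PiTensorProduct.mapL (fun k => TraceClass.compress (A k)) z) atTop (𝓝 z) := by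
  induction z using PiTensorProduct.induction_on with
  | smul_tprod r T =>
    simp only [map_smul]
    refine Tendsto.const_smul ?_ r
    simp only [PiTensorProduct.mapL_apply, PiTensorProduct.map_tprod, coe_coe]
    have h1 : Tendsto (fun (A : ∀ k, Finset (stdIndex (H k))) k =>
        TraceClass.compress (A k) (T k)) atTop (𝓝 T) := by
      refine tendsto_pi_nhds.2 fun k => (TraceClass.tendsto_compress (T k)).comp ?_
      -- A family above the one equal to `b` at `k` and empty elsewhere contains `b` in its `k`-th
      -- set.
      exact tendsto_atTop.2 fun b => (eventually_ge_atTop (Function.update (fun _ => ∅) k b)).mono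
        fun A hA => by simpa using hA k
    have h2 := ((PiTensorProduct.tprodL ℂ (E := fun k => TraceClass (H k))).cont.tendsto T).comp h1
    simpa [Function.comp_def] using h2
  | add x y hx hy =>
    simp only [map_add]
    exact hx.add hy

end TensorTraceClass

end

/-! ### The entanglement as a projective norm -/

theorem theorem8p1 {N : ℕ} (H : Fin N → Type*) [∀ k, NormedAddCommGroup (H k)]
    [∀ k, InnerProductSpace ℂ (H k)] [∀ k, CompleteSpace (H k)]
    (k₀ : Fin N) (hfin : ∀ k, k ≠ k₀ → FiniteDimensional ℂ (H k))
    (ρ : (HilbertTensor H →L[ℂ] HilbertTensor H) →ₗ[ℂ] ℂ) (hρ : IsNormalState ρ)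
    (A : TraceClass (HilbertTensor H)) (hA : HasDensity ρ A) :
    (∃! z : ⨂[ℂ] k, TraceClass (H k), tensorToOp z = TraceClass.toOp A) ∧
      ∀ z : ⨂[ℂ] k, TraceClass (H k), tensorToOp z = TraceClass.toOp A →
        entanglement (productVectors H) ρ = ENNReal.ofReal ‖z‖ := by
  classical
  -- The dummy index needs `H k₀ ≠ 0`. Otherwise all product vectors vanish, so `1 = 0` on the
  -- tensor product, contrary to `ρ 1 = 1`.
  have hi₀ : Nonempty (stdIndex (H k₀)) := by
    by_contra hne
    rw [not_nonempty_iff] at hne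
    have h0 : ∀ x : H k₀, x = 0 := fun x => by
      have := parseval_enorm x
      simpa [tsum_empty] using this.symm
    have h1 : (1 : HilbertTensor H →L[ℂ] HilbertTensor H) = 0 := ext_tensorVec fun x => by
      have h2 : tensorVec x = 0 := (tensorVecM H).map_coord_zero k₀ (h0 _)
      simp [h2]
    have h3 := hρ.map_one
    rw [h1, map_zero] at h3
    exact zero_ne_one h3
  obtain ⟨i₀⟩ := hi₀
  have hfull : ∀ k, k ≠ k₀ → ∃ B : Finset (stdIndex (H k)), basisProj B = 1 := fun k hk => by
    have := hfin k hk
    have hf : Finite (stdIndex (H k)) :=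
      (stdBasis (H k)).orthonormal.linearIndependent.finite
    have := Fintype.ofFinite (stdIndex (H k))
    refine ⟨Finset.univ, ?_⟩
    ext x
    rw [basisProj_apply]
    have h := (stdBasis (H k)).hasSum_repr x
    simp only [HilbertBasis.repr_apply_apply] at h
    exact (hasSum_fintype _).unique h
  choose! B hB using hfull
  -- Full bases away from `k₀`, and a single dummy index at `k₀`.
  set C : ∀ k, Finset (stdIndex (H k)) := Function.update B k₀ {i₀} with hC
  have hC₀ : C k₀ = {i₀} := by simp [hC]
  have hC₁ : ∀ k, k ≠ k₀ → basisProj (C k) = 1 := fun k hk => by simp [hC, hk, hB k hk]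
  obtain ⟨Φ, hΦ⟩ := exists_tensorToTraceClass hC₀ hC₁
  have hiff : ∀ z, tensorToOp z = A.toOp ↔ Φ z = A := fun z => by
    rw [← hΦ]; exact TraceClass.toOp_injective.eq_iff
  simp only [hiff]
  refine ⟨(bijective_tensorToTraceClass hΦ hC₀ hC₁).existsUnique A, ?_⟩
  rintro z rfl
  have hρ' : ∀ X, ρ X = TraceClass.pairing (Φ z) X := fun X => hA X
  refine le_antisymm ?_ ?_
  · refine iSup₂_le fun X hX => ?_
    rw [hρ', ← ofReal_norm]
    refine ENNReal.ofReal_le_ofReal (norm_pairing_tensor_le hΦ (fun T k => ?_) hX.2 z)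
    -- Separate continuity comes from the block formula at `k₀` and from finite dimension at the
    -- other factors.
    by_cases hk : k = k₀
    · subst hk
      exact (TraceClass.continuous_pairing X).comp (continuous_tprod_update hΦ hC₀ hC₁ T)
    · have := hfin k hk
      have := finiteDimensional_traceClass (K := H k)
      exact (((TraceClass.pairing.flip X).comp Φ).comp
        ((PiTensorProduct.tprod ℂ).toLinearMap T k)).continuous_of_finiteDimensional
  · obtain ⟨g, hg, hgz⟩ := exists_dual_vector'' ℂ z
    have hlim : Tendsto (fun D : ∀ k, Finset (stdIndex (H k)) =>
        ‖g (PiTensorProduct.mapL (fun k => TraceClass.compress (D k)) z)‖ₑ) atTop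
        (𝓝 (ENNReal.ofReal ‖z‖)) := by
      have h1 := ((g.continuous.tendsto z).comp (tendsto_mapL_compress z)).enorm
      rwa [hgz, ← ofReal_norm (RCLike.ofReal ‖z‖ : ℂ), RCLike.norm_ofReal, abs_norm] at h1
    refine le_of_tendsto hlim (Eventually.of_forall fun D => ?_)
    have h2 := pairing_dualOp hΦ g.toLinearMap D z
    rw [coe_coe] at h2
    rw [← h2, ← hρ']
    exact le_iSup₂_of_le (f := fun X (_ : X ∈ {X ∈ testOperators (HilbertTensor H) |
      opNormOn (productVectors H) X ≤ 1}) => ‖ρ X‖ₑ) (dualOp g.toLinearMap D)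
      -- The witness is compact, so its scalar part is `0`.
      ⟨⟨_, 0, isCompactOperator_dualOp g.toLinearMap D, by simp⟩, opNormOn_dualOp_le hΦ hg D⟩
      le_rfl
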